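/- Let $m,n\ge 0$ be integers and let $(M,g)$ be a smooth $m$-dimensional Riemannian manifold (Hausdorff, without boundary). Let $\Delta=\operatorname{div}\circ\operatorname{grad}$ be the Laplacian of $(M,g)$, acting componentwise on $\mathbb{R}^{n+1}$-valued functions, and let $S^n\subset\mathbb{R}^{n+1}$ be the unit sphere centred at the origin. A smooth map $\varphi:(M,g)\to S^n$ is called biharmonic if it is a critical point, with respect to compactly supported smooth variations through maps $M\to S^n$, of the bienergy $E_2(\varphi)=\frac12\int_M|\tau(\varphi)|^2\,dv_g$, where $\tau(\varphi)=\operatorname{Tr}_g\nabla d\varphi$ is the tension field. Let $\phi:(M,g)\to\mathbb{R}^{n+1}$ be a smooth isometric immersion such that $\Delta^2\phi=\lambda\,\phi$ for some function $\lambda:M\to\mathbb{R}$. Suppose that $\phi(M)\subset S^n$ and that $\phi$, regarded as a map $(M,g)\to S^n$, is biharmonic. Then $\lambda(x)=m^2$ for all $x\in M$, the isometric immersion $\phi:(M,g)\to S^n$ is minimal (its mean curvature vector field vanishes identically), and $\Delta\phi=-m\,\phi$. -/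

import Mathlib

open scoped Manifold ContDiff

noncomputable section

namespace BiharmonicSphere

variable {m n : ℕ} {M : Type*} [TopologicalSpace M]
  [ChartedSpace (EuclideanSpace ℝ (Fin m)) M] [IsManifold (𝓡 m) ∞ M]

/-- A smooth (positive definite) Riemannian metric on the `m`-dimensional manifold `M`. -/
abbrev SmoothMetric (m : ℕ) (M : Type*) [TopologicalSpace M]
    [ChartedSpace (EuclideanSpace ℝ (Fin m)) M] [IsManifold (𝓡 m) ∞ M] :=
  Bundle.ContMDiffRiemannianMetric (𝓡 m) ∞ (EuclideanSpace ℝ (Fin m))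
    (fun x : M => TangentSpace (𝓡 m) x)

/-- The coordinate charts of `M`, with values in `ℝᵐ`: all charts of its smooth structure. -/
abbrev IsSmoothChart (e : OpenPartialHomeomorph M (EuclideanSpace ℝ (Fin m))) : Prop :=
  e ∈ IsManifold.maximalAtlas (𝓡 m) ∞ M

/-- The partial derivative `∂ᵢ F` of a function of `m` real variables. -/
def partialD {V : Type*} [NormedAddCommGroup V] [NormedSpace ℝ V] (i : Fin m)
    (F : EuclideanSpace ℝ (Fin m) → V) (y : EuclideanSpace ℝ (Fin m)) : V :=
  fderiv ℝ F y (EuclideanSpace.single i 1)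

/-- The coordinate vector field `∂ᵢ` of the chart `e`, at the point with coordinates `y`. -/
def coordVector (e : OpenPartialHomeomorph M (EuclideanSpace ℝ (Fin m))) (i : Fin m)
    (y : EuclideanSpace ℝ (Fin m)) : TangentSpace (𝓡 m) (e.symm y) :=
  mfderiv (𝓡 m) (𝓡 m) e.symm y (EuclideanSpace.single i (1 : ℝ))

/-- The matrix `(g_{ij})` of the metric in the chart `e`, as a function of the coordinates. -/
def metricMatrix (g : SmoothMetric m M)
    (e : OpenPartialHomeomorph M (EuclideanSpace ℝ (Fin m)))
    (y : EuclideanSpace ℝ (Fin m)) : Matrix (Fin m) (Fin m) ℝ :=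
  Matrix.of fun i j => g.inner (e.symm y) (coordVector e i y) (coordVector e j y)

/-- The Riemannian volume density `√(det (g_{ij}))` in the chart `e`. -/
def volumeDensity (g : SmoothMetric m M)
    (e : OpenPartialHomeomorph M (EuclideanSpace ℝ (Fin m)))
    (y : EuclideanSpace ℝ (Fin m)) : ℝ :=
  Real.sqrt (metricMatrix g e y).det

/-- The Christoffel symbol `Γᵏ_{ij}` of the Levi-Civita connection of `g` in the chart `e`. -/
def christoffel (g : SmoothMetric m M)
    (e : OpenPartialHomeomorph M (EuclideanSpace ℝ (Fin m))) (k i j : Fin m)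
    (y : EuclideanSpace ℝ (Fin m)) : ℝ :=
  (1 / 2 : ℝ) * ∑ l, (metricMatrix g e y)⁻¹ k l *
    (partialD i (fun z => metricMatrix g e z j l) y
      + partialD j (fun z => metricMatrix g e z i l) y
      - partialD l (fun z => metricMatrix g e z i j) y)

/-- The Laplacian `Δf = div (grad f)` in the chart `e`, at the point with coordinates `y`:
`(1 / √det g) ∑ᵢ ∂ᵢ (√det g ∑ⱼ gⁱʲ ∂ⱼ f)`. It acts on vector valued functions componentwise. -/
def chartLaplacian {V : Type*} [NormedAddCommGroup V] [NormedSpace ℝ V] (g : SmoothMetric m M)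
    (e : OpenPartialHomeomorph M (EuclideanSpace ℝ (Fin m))) (f : M → V)
    (y : EuclideanSpace ℝ (Fin m)) : V :=
  (volumeDensity g e y)⁻¹ • ∑ i, partialD i
    (fun z => volumeDensity g e z •
      ∑ j, (metricMatrix g e z)⁻¹ i j • partialD j (f ∘ e.symm) z) y

/-- `h` is the Laplacian `Δf` of `f` on the Riemannian manifold `(M, g)`: in every chart it is
given by the coordinate expression of `div (grad f)`. -/
def IsLaplacian {V : Type*} [NormedAddCommGroup V] [NormedSpace ℝ V] (g : SmoothMetric m M)
    (f h : M → V) : Prop :=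
  ∀ e : OpenPartialHomeomorph M (EuclideanSpace ℝ (Fin m)), IsSmoothChart e →
    ∀ x ∈ e.source, h x = chartLaplacian g e f (e x)

/-- `k` is the bi-Laplacian `Δ²f = Δ(Δf)` of `f`. -/
def IsBiLaplacian {V : Type*} [NormedAddCommGroup V] [NormedSpace ℝ V] (g : SmoothMetric m M)
    (f k : M → V) : Prop :=
  ∃ h : M → V, IsLaplacian g f h ∧ IsLaplacian g h k

/-- `φ : (M, g) → ℝⁿ⁺¹` is an isometric immersion: it is smooth and its differential preserves
inner products (hence is injective). -/
def IsIsometricImmersion (g : SmoothMetric m M) (φ : M → EuclideanSpace ℝ (Fin (n + 1))) :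
    Prop :=
  ContMDiff (𝓡 m) (𝓡 (n + 1)) ∞ φ ∧
    ∀ (x : M) (v w : TangentSpace (𝓡 m) x),
      inner (E := EuclideanSpace ℝ (Fin (n + 1))) ℝ
        (mfderiv (𝓡 m) (𝓡 (n + 1)) φ x v) (mfderiv (𝓡 m) (𝓡 (n + 1)) φ x w) = g.inner x v w

/-- The orthogonal projection of `ℝⁿ⁺¹` onto the tangent space `u^⊥` of the unit sphere `Sⁿ` at
the point `u`. -/
def sphereTangentProj (u v : EuclideanSpace ℝ (Fin (n + 1))) : EuclideanSpace ℝ (Fin (n + 1)) :=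
  v - inner ℝ u v • u

/-- The second fundamental form `(∇dψ)(∂ᵢ, ∂ⱼ) = ∇^ψ_{∂ᵢ}(dψ ∂ⱼ) - dψ(∇_{∂ᵢ} ∂ⱼ)` of a map
`ψ : (M, g) → Sⁿ ⊆ ℝⁿ⁺¹` in the chart `e`. The pullback `∇^ψ` of the Levi-Civita connection of
`Sⁿ` is differentiation in `ℝⁿ⁺¹` followed by the projection onto the tangent space of `Sⁿ`. -/
def nablaD (g : SmoothMetric m M) (e : OpenPartialHomeomorph M (EuclideanSpace ℝ (Fin m)))
    (ψ : M → EuclideanSpace ℝ (Fin (n + 1))) (i j : Fin m) (y : EuclideanSpace ℝ (Fin m)) :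
    EuclideanSpace ℝ (Fin (n + 1)) :=
  sphereTangentProj (ψ (e.symm y)) (partialD i (partialD j (ψ ∘ e.symm)) y)
    - ∑ k, christoffel g e k i j y • partialD k (ψ ∘ e.symm) y

/-- The tension field `τ(ψ) = Tr_g ∇dψ` of a map `ψ : (M, g) → Sⁿ ⊆ ℝⁿ⁺¹`, in the chart `e`. -/
def tensionField (g : SmoothMetric m M)
    (e : OpenPartialHomeomorph M (EuclideanSpace ℝ (Fin m)))
    (ψ : M → EuclideanSpace ℝ (Fin (n + 1))) (y : EuclideanSpace ℝ (Fin m)) :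
    EuclideanSpace ℝ (Fin (n + 1)) :=
  ∑ i, ∑ j, (metricMatrix g e y)⁻¹ i j • nablaD g e ψ i j y

/-- The bienergy `½ ∫_K |τ(ψ)|² dv_g` of a map `ψ : (M, g) → Sⁿ` over a compact subset `K` of the
domain of the chart `e`. -/
def bienergyOn (g : SmoothMetric m M)
    (e : OpenPartialHomeomorph M (EuclideanSpace ℝ (Fin m))) (K : Set M)
    (ψ : M → EuclideanSpace ℝ (Fin (n + 1))) : ℝ :=
  (1 / 2 : ℝ) * ∫ y in e '' K, ‖tensionField g e ψ y‖ ^ 2 * volumeDensity g e y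

/-- `Ψ` is a smooth variation of `φ` through maps `M → Sⁿ` which is supported in `K`. -/
structure IsSphereVariation (m : ℕ) {n : ℕ} {M : Type*} [TopologicalSpace M]
    [ChartedSpace (EuclideanSpace ℝ (Fin m)) M]
    (φ : M → EuclideanSpace ℝ (Fin (n + 1))) (K : Set M) (Ψ : ℝ → M → EuclideanSpace ℝ (Fin (n + 1))) : Prop where
  smooth : ContMDiff (𝓘(ℝ, ℝ).prod (𝓡 m)) (𝓡 (n + 1)) ∞ (fun p : ℝ × M => Ψ p.1 p.2)
  mem_sphere : ∀ t x, Ψ t x ∈ Metric.sphere (0 : EuclideanSpace ℝ (Fin (n + 1))) 1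
  initial : Ψ 0 = φ
  eq_off : ∀ t, ∀ x ∉ K, Ψ t x = φ x

/-- A smooth map `φ : (M, g) → Sⁿ ⊆ ℝⁿ⁺¹` is biharmonic if it is a critical point of the bienergy
with respect to compactly supported smooth variations through maps into `Sⁿ`. As the first
variation is linear in the variation field, a partition of unity shows that it is enough to test
this on variations supported in a compact subset of a coordinate domain. -/
def IsBiharmonicIntoSphere (g : SmoothMetric m M) (φ : M → EuclideanSpace ℝ (Fin (n + 1))) :
    Prop :=
  ContMDiff (𝓡 m) (𝓡 (n + 1)) ∞ φ ∧
  (∀ x, φ x ∈ Metric.sphere (0 : EuclideanSpace ℝ (Fin (n + 1))) 1) ∧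
  ∀ e : OpenPartialHomeomorph M (EuclideanSpace ℝ (Fin m)), IsSmoothChart e →
    ∀ K : Set M, IsCompact K → K ⊆ e.source →
      ∀ Ψ : ℝ → M → EuclideanSpace ℝ (Fin (n + 1)), IsSphereVariation m φ K Ψ →
        HasDerivAt (fun t => bienergyOn g e K (Ψ t)) 0 0

/-- The normal space in `Sⁿ` of the immersed submanifold `φ : M → Sⁿ`, at the point with
coordinates `y`: the vectors orthogonal to the position vector and to the image of `dφ`. -/
def normalSpace (e : OpenPartialHomeomorph M (EuclideanSpace ℝ (Fin m)))
    (φ : M → EuclideanSpace ℝ (Fin (n + 1))) (y : EuclideanSpace ℝ (Fin m)) :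
    Submodule ℝ (EuclideanSpace ℝ (Fin (n + 1))) :=
  (Submodule.span ℝ
    (insert (φ (e.symm y)) (Set.range fun k => partialD k (φ ∘ e.symm) y)))ᗮ

/-- The mean curvature vector `η = (1/m) Tr_g B` of an isometric immersion `φ : (M, g) → Sⁿ`, in
the chart `e`. Here `B(∂ᵢ, ∂ⱼ)`, the second fundamental form of the submanifold of `Sⁿ`, is the
component of `∂ᵢ∂ⱼφ` in the normal space. -/
def meanCurvatureVector (g : SmoothMetric m M)
    (e : OpenPartialHomeomorph M (EuclideanSpace ℝ (Fin m)))
    (φ : M → EuclideanSpace ℝ (Fin (n + 1))) (y : EuclideanSpace ℝ (Fin m)) :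
    EuclideanSpace ℝ (Fin (n + 1)) :=
  (1 / m : ℝ) • ∑ i, ∑ j, (metricMatrix g e y)⁻¹ i j •
    (normalSpace e φ y).starProjection (partialD i (partialD j (φ ∘ e.symm)) y)

/-- The isometric immersion `φ : (M, g) → Sⁿ ⊆ ℝⁿ⁺¹` is minimal: its mean curvature vector
vanishes identically. -/
def IsMinimalInSphere (g : SmoothMetric m M) (φ : M → EuclideanSpace ℝ (Fin (n + 1))) : Prop :=
  IsIsometricImmersion g φ ∧
  (∀ x, φ x ∈ Metric.sphere (0 : EuclideanSpace ℝ (Fin (n + 1))) 1) ∧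
  ∀ e : OpenPartialHomeomorph M (EuclideanSpace ℝ (Fin m)), IsSmoothChart e →
    ∀ x ∈ e.source, meanCurvatureVector g e φ (e x) = 0

end BiharmonicSphere

end

open scoped Manifold ContDiff

noncomputable section

set_option linter.unusedSectionVars false

/-! Differentiating `|φ|² = 1` twice gives `⟨φ, ∂ᵢ∂ⱼφ⟩ = -gᵢⱼ`, whose trace is `-m`; hence `τ = Δφ +
mφ` and `τ ⟂ φ` (`tensionField_of_isometricImmersion`, `inner_tensionField`). The hypothesis `Δ²φ =
λφ` then gives `Δτ = mτ + (λ - m²)φ`, so `⟨Δτ, τ⟩ = m|τ|²`, whatever `λ` is.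

Biharmonicity enters only weakly: `∫ ⟨τ, Δζ + mζ⟩ dv = 0` for fields `ζ ⟂ φ` compactly supported in
a chart (`hasDerivAt_bienergyOn`, `integral_inner_tensionField_eq_zero`). Testing with `ζ = fτ`, `f`
a bump function, and moving `Δ` onto `τ` by Green's formula (`coordLaplacian_symmetric`) yields `∫
2m f |τ|² dv = 0`, so `τ = 0` (`tensionField_eq_zero`). Thus `Δφ = -mφ`; its normal part is
minimality, and applying `Δ` again gives `λ = m²`.

The Laplacian is needed in two forms: divergence form for Green's formula, and `gⁱʲ(∂ᵢ∂ⱼ - Γᵏᵢⱼ∂ₖ)`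
for comparison with the tension field and for differentiation in the variation parameter.
`sum_partialD_density_smul` links them. -/

namespace BiharmonicSphere

/-! ### Rules for partial derivatives. -/

section PartialD

variable {m : ℕ} {V : Type*} [NormedAddCommGroup V] [NormedSpace ℝ V]
  {U : Set (EuclideanSpace ℝ (Fin m))} {y : EuclideanSpace ℝ (Fin m)}

theorem contDiffOn_partialD {F : EuclideanSpace ℝ (Fin m) → V} (hU : IsOpen U)
    (hF : ContDiffOn ℝ ∞ F U) (i : Fin m) : ContDiffOn ℝ ∞ (partialD i F) U :=
  (hF.fderiv_of_isOpen hU (m := ∞) (by simp)).clm_apply contDiffOn_const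

theorem partialD_eqOn {F G : EuclideanSpace ℝ (Fin m) → V} (hU : IsOpen U)
    (h : Set.EqOn F G U) (i : Fin m) : Set.EqOn (partialD i F) (partialD i G) U := fun y hy => by
  have : F =ᶠ[nhds y] G := Filter.eventuallyEq_of_mem (hU.mem_nhds hy) h
  simp only [partialD, this.fderiv_eq]

theorem differentiableAt_of_contDiffOn {E' : Type*} [NormedAddCommGroup E'] [NormedSpace ℝ E']
    {U : Set E'} {y : E'} {F : E' → V} (hU : IsOpen U)
    (hF : ContDiffOn ℝ ∞ F U) (hy : y ∈ U) : DifferentiableAt ℝ F y :=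
  (hF.contDiffAt (hU.mem_nhds hy)).differentiableAt (by simp)

theorem partialD_add {F G : EuclideanSpace ℝ (Fin m) → V} (i : Fin m)
    (hF : DifferentiableAt ℝ F y) (hG : DifferentiableAt ℝ G y) :
    partialD i (fun z => F z + G z) y = partialD i F y + partialD i G y := by
  simp [partialD, fderiv_fun_add hF hG]

theorem partialD_const_smul (c : ℝ) (F : EuclideanSpace ℝ (Fin m) → V) (i : Fin m) :
    partialD i (fun z => c • F z) y = c • partialD i F y := by
  have : (fun z => c • F z) = c • F := rfl
  simp [partialD, this, fderiv_const_smul_field]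

theorem partialD_smul {a : EuclideanSpace ℝ (Fin m) → ℝ} {F : EuclideanSpace ℝ (Fin m) → V}
    (i : Fin m) (ha : DifferentiableAt ℝ a y) (hF : DifferentiableAt ℝ F y) :
    partialD i (fun z => a z • F z) y = a y • partialD i F y + partialD i a y • F y := by
  simp [partialD, fderiv_fun_smul ha hF]

theorem partialD_mul {a b : EuclideanSpace ℝ (Fin m) → ℝ}
    (i : Fin m) (ha : DifferentiableAt ℝ a y) (hb : DifferentiableAt ℝ b y) :
    partialD i (fun z => a z * b z) y = a y * partialD i b y + partialD i a y * b y := by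
  simpa using partialD_smul i ha hb

theorem partialD_sum {ι : Type*} (s : Finset ι) {F : ι → EuclideanSpace ℝ (Fin m) → V}
    (i : Fin m) (hF : ∀ k ∈ s, DifferentiableAt ℝ (F k) y) :
    partialD i (fun z => ∑ k ∈ s, F k z) y = ∑ k ∈ s, partialD i (F k) y := by
  simp [partialD, fderiv_fun_sum hF]

theorem partialD_inner {V : Type*} [NormedAddCommGroup V] [InnerProductSpace ℝ V]
    {F G : EuclideanSpace ℝ (Fin m) → V} (i : Fin m)
    (hF : DifferentiableAt ℝ F y) (hG : DifferentiableAt ℝ G y) :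
    partialD i (fun z => inner ℝ (F z) (G z)) y =
      inner ℝ (F y) (partialD i G y) + inner ℝ (partialD i F y) (G y) := by
  simp [partialD, fderiv_inner_apply ℝ hF hG]

theorem partialD_const (c : V) (i : Fin m) : partialD i (fun _ => c) y = 0 := by
  simp [partialD]

end PartialD

/-! ### Derivatives of determinants and of inverse matrices. -/

section MatrixCalculus

variable {ι : Type*} [Fintype ι] [DecidableEq ι] {E' : Type*} [NormedAddCommGroup E']
  [NormedSpace ℝ E'] {U : Set E'} {A : E' → Matrix ι ι ℝ}

theorem contDiffOn_det {k : WithTop ℕ∞} (hA : ∀ i j, ContDiffOn ℝ k (fun z => A z i j) U) :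
    ContDiffOn ℝ k (fun z => (A z).det) U := by
  simp only [Matrix.det_apply]
  exact ContDiffOn.sum fun σ _ => (contDiffOn_prod fun i _ => hA _ _).const_smul _

theorem contDiffOn_matrix_inv {k : WithTop ℕ∞} (hA : ∀ i j, ContDiffOn ℝ k (fun z => A z i j) U)
    (hdet : ∀ z ∈ U, (A z).det ≠ 0) (i j : ι) :
    ContDiffOn ℝ k (fun z => (A z)⁻¹ i j) U := by
  simp only [Matrix.inv_def, Matrix.smul_apply, Matrix.adjugate_apply, Ring.inverse_eq_inv',
    smul_eq_mul]
  refine ((contDiffOn_det hA).inv hdet).mul (contDiffOn_det fun a b => ?_)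
  by_cases h : a = j
  · subst h
    simpa using contDiffOn_const
  · simpa [Matrix.updateRow_ne h] using hA a b

/-- Factoring out `B` reduces this to `det (1 + tC) = 1 + t tr C + t² p(t)` with `p` a polynomial.
-/
theorem hasDerivAt_det_add_smul (B H : Matrix ι ι ℝ) (hB : B.det ≠ 0) :
    HasDerivAt (fun t : ℝ => (B + t • H).det) (B.det * (B⁻¹ * H).trace) 0 := by
  have h1 : ∀ t : ℝ, (B + t • H).det = B.det * (1 + t • (B⁻¹ * H)).det := fun t => by
    rw [← Matrix.det_mul, mul_add, mul_one, Matrix.mul_smul, ← mul_assoc,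
      Matrix.mul_nonsing_inv _ (isUnit_iff_ne_zero.2 hB), one_mul]
  have h2 := fun t : ℝ => Matrix.det_one_add_smul t (B⁻¹ * H)
  simp_rw [h1]
  refine HasDerivAt.const_mul _ ?_
  rw [funext h2]
  set p := ((1 + (Polynomial.X : Polynomial ℝ) • (B⁻¹ * H).map Polynomial.C).det).divX.divX
  have := (((hasDerivAt_id (0 : ℝ)).const_mul (B⁻¹ * H).trace).const_add 1).add
    ((p.hasDerivAt 0).mul ((hasDerivAt_id (0 : ℝ)).pow 2))
  simpa using! this

/-- Jacobi's formula. The determinant is smooth in the entries, so its derivative can be read off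
along the line `A z + t H`, with `H` the derivative of `A` along `v`. -/
theorem fderiv_det {z : E'} (hA : ∀ i j, DifferentiableAt ℝ (fun z => A z i j) z)
    (hdet : (A z).det ≠ 0) (v : E') :
    fderiv ℝ (fun z => (A z).det) z v =
      (A z).det * ∑ k, ∑ l, (A z)⁻¹ k l * fderiv ℝ (fun z => A z l k) z v := by
  let D : (ι → ι → ℝ) → ℝ := fun B => (Matrix.of B).det
  have hD : ContDiff ℝ 1 D := by
    rw [← contDiffOn_univ]
    refine contDiffOn_det fun i j => ?_
    simp only [Matrix.of_apply]
    fun_prop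
  have hdA : HasFDerivAt (fun z => (fun i j => A z i j : ι → ι → ℝ))
      (ContinuousLinearMap.pi fun i => ContinuousLinearMap.pi fun j =>
        fderiv ℝ (fun z => A z i j) z) z :=
    hasFDerivAt_pi.2 fun i => hasFDerivAt_pi.2 fun j => (hA i j).hasFDerivAt
  have hDd := (hD.differentiable (by simp)).differentiableAt (x := fun i j => A z i j)
  have hc := hDd.hasFDerivAt.comp z hdA
  have h2 : fderiv ℝ (fun z => (A z).det) z v = fderiv ℝ D (fun i j => A z i j)
      (fun i j => fderiv ℝ (fun z => A z i j) z v) := by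
    rw [show (fun z => (A z).det) = D ∘ fun z => (fun i j => A z i j) from rfl, hc.fderiv]
    rfl
  set H : ι → ι → ℝ := fun i j => fderiv ℝ (fun z => A z i j) z v
  have h3 : HasDerivAt (fun t : ℝ => D ((fun i j => A z i j) + t • H))
      (fderiv ℝ D (fun i j => A z i j) H) 0 := hDd.hasFDerivAt.hasLineDerivAt H
  have h4 := hasDerivAt_det_add_smul (A z) (Matrix.of H) hdet
  rw [h2, h3.unique h4]
  simp [Matrix.trace, Matrix.mul_apply, H]

/-- Differentiate `A A⁻¹ = 1` and multiply by `A⁻¹` on the left. -/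
theorem fderiv_matrix_inv (hU : IsOpen U) (hA : ∀ i j, ContDiffOn ℝ ∞ (fun z => A z i j) U)
    (hdet : ∀ z ∈ U, (A z).det ≠ 0) {z : E'} (hz : z ∈ U) (v : E') (i j : ι) :
    fderiv ℝ (fun z => (A z)⁻¹ i j) z v =
      -∑ a, ∑ b, (A z)⁻¹ i a * fderiv ℝ (fun z => A z a b) z v * (A z)⁻¹ b j := by
  have dA := fun i j => differentiableAt_of_contDiffOn hU (hA i j) hz
  have dI := fun i j => differentiableAt_of_contDiffOn hU (contDiffOn_matrix_inv hA hdet i j) hz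
  set P : Matrix ι ι ℝ := Matrix.of fun i j => fderiv ℝ (fun z => A z i j) z v with hP
  set Q : Matrix ι ι ℝ := Matrix.of fun i j => fderiv ℝ (fun z => (A z)⁻¹ i j) z v with hQ
  have key : P * (A z)⁻¹ + A z * Q = 0 := by
    ext a b
    have h1 : (fun z => ∑ c, A z a c * (A z)⁻¹ c b) =ᶠ[nhds z]
        fun _ => (1 : Matrix ι ι ℝ) a b := by
      filter_upwards [hU.mem_nhds hz] with x hx
      rw [← Matrix.mul_apply, Matrix.mul_nonsing_inv _ (isUnit_iff_ne_zero.2 (hdet x hx))]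
    have h2 := congrArg (fun L : E' →L[ℝ] ℝ => L v) h1.fderiv_eq
    rw [fderiv_fun_sum fun c _ => (dA a c).fun_mul (dI c b)] at h2
    simp only [fderiv_fun_mul (dA _ _) (dI _ _)] at h2
    simp only [fderiv_fun_const] at h2
    simp only [Matrix.add_apply, Matrix.mul_apply, hP, hQ, Matrix.of_apply, Matrix.zero_apply]
    rw [← Finset.sum_add_distrib]
    simpa [mul_comm, add_comm] using h2
  have key2 : Q = -((A z)⁻¹ * P * (A z)⁻¹) := by
    have h3 : (A z)⁻¹ * (P * (A z)⁻¹ + A z * Q) = 0 := by rw [key, mul_zero]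
    rw [mul_add, ← mul_assoc, ← mul_assoc,
      Matrix.nonsing_inv_mul _ (isUnit_iff_ne_zero.2 (hdet z hz)), one_mul] at h3
    exact eq_neg_of_add_eq_zero_right h3
  have := congrFun (congrFun key2 i) j
  rw [hQ, Matrix.of_apply] at this
  rw [this, Matrix.neg_apply, Matrix.mul_apply]
  simp only [Matrix.mul_apply, Finset.sum_mul, hP, Matrix.of_apply]
  rw [Finset.sum_comm]

end MatrixCalculus

/-! ### The metric in a chart. -/

section Chart

variable {m n : ℕ} {M : Type*} [TopologicalSpace M]
  [ChartedSpace (EuclideanSpace ℝ (Fin m)) M] [IsManifold (𝓡 m) ∞ M]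
  {g : SmoothMetric m M} {e : OpenPartialHomeomorph M (EuclideanSpace ℝ (Fin m))}
  {y : EuclideanSpace ℝ (Fin m)}

theorem metricMatrix_comm (g : SmoothMetric m M)
    (e : OpenPartialHomeomorph M (EuclideanSpace ℝ (Fin m))) (y : EuclideanSpace ℝ (Fin m))
    (i j : Fin m) : metricMatrix g e y i j = metricMatrix g e y j i :=
  g.symm _ _ _

theorem metricMatrix_inv_comm (g : SmoothMetric m M)
    (e : OpenPartialHomeomorph M (EuclideanSpace ℝ (Fin m))) (y : EuclideanSpace ℝ (Fin m))
    (i j : Fin m) : (metricMatrix g e y)⁻¹ i j = (metricMatrix g e y)⁻¹ j i := by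
  have h : (metricMatrix g e y).transpose = metricMatrix g e y := by
    ext a b; exact metricMatrix_comm g e y b a
  have h2 := Matrix.transpose_nonsing_inv (metricMatrix g e y)
  rw [h] at h2
  exact congrFun (congrFun h2 j) i

theorem mdifferentiableAt_chart (he : IsSmoothChart e) {x : M} (hx : x ∈ e.source) :
    MDifferentiableAt (𝓡 m) (𝓡 m) e x :=
  (contMDiffAt_of_mem_maximalAtlas he hx).mdifferentiableAt (by simp)

theorem contMDiffAt_chart_symm (he : IsSmoothChart e) (hy : y ∈ e.target) :
    ContMDiffAt (𝓡 m) (𝓡 m) ∞ e.symm y :=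
  (contMDiffOn_symm_of_mem_maximalAtlas he).contMDiffAt (e.open_target.mem_nhds hy)

/-- The chain rule for `e ∘ e.symm = id` provides a left inverse of the differential. -/
theorem mfderiv_chart_symm_ne_zero (he : IsSmoothChart e) (hy : y ∈ e.target)
    {v : EuclideanSpace ℝ (Fin m)} (hv : v ≠ 0) :
    mfderiv (𝓡 m) (𝓡 m) e.symm y v ≠ 0 := by
  intro h0
  have h1 : (e ∘ e.symm) =ᶠ[nhds y] id := by
    filter_upwards [e.open_target.mem_nhds hy] with z hz using e.right_inv hz
  have h2 : mfderiv (𝓡 m) (𝓡 m) (e ∘ e.symm) y =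
      (mfderiv (𝓡 m) (𝓡 m) e (e.symm y)).comp (mfderiv (𝓡 m) (𝓡 m) e.symm y) :=
    mfderiv_comp y (mdifferentiableAt_chart he (e.map_target hy))
      ((contMDiffAt_chart_symm he hy).mdifferentiableAt (by simp))
  rw [h1.mfderiv_eq, mfderiv_id] at h2
  have h3 : v = mfderiv (𝓡 m) (𝓡 m) e (e.symm y) (mfderiv (𝓡 m) (𝓡 m) e.symm y v) :=
    congrArg (fun L : EuclideanSpace ℝ (Fin m) →L[ℝ] EuclideanSpace ℝ (Fin m) => L v) h2
  rw [h0] at h3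
  exact hv (h3.trans (map_zero (mfderiv (𝓡 m) (𝓡 m) e (e.symm y))))

theorem metricMatrix_posDef (he : IsSmoothChart e) (hy : y ∈ e.target) :
    (metricMatrix g e y).PosDef := by
  refine Matrix.PosDef.of_dotProduct_mulVec_pos ?_ fun v hv => ?_
  · ext i j
    simpa using metricMatrix_comm g e y j i
  · set v' : EuclideanSpace ℝ (Fin m) := WithLp.toLp 2 v with hv'
    have hne : v' ≠ 0 := by simpa [hv'] using hv
    have hsum : mfderiv (𝓡 m) (𝓡 m) e.symm y v' = ∑ i, v i • coordVector e i y := by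
      have : v' = ∑ i, v i • EuclideanSpace.single i (1 : ℝ) := by
        ext j
        simp [hv', Pi.single_apply]
      let L : EuclideanSpace ℝ (Fin m) →L[ℝ] TangentSpace (𝓡 m) (e.symm y) :=
        mfderiv (𝓡 m) (𝓡 m) e.symm y
      change L v' = ∑ i, v i • L (EuclideanSpace.single i 1)
      rw [this, map_sum]
      simp only [map_smul]
    have := g.pos (e.symm y) _ (mfderiv_chart_symm_ne_zero he hy hne)
    rw [hsum] at this
    refine this.trans_eq ?_
    rw [map_sum]
    refine Finset.sum_congr rfl fun i _ => ?_
    rw [g.symm, map_sum, Matrix.mulVec, dotProduct, Finset.mul_sum]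
    refine Finset.sum_congr rfl fun j _ => ?_
    rw [map_smul, map_smul, smul_apply, smul_eq_mul, smul_eq_mul]
    simp only [metricMatrix, Matrix.of_apply, Pi.star_apply, star_trivial]
    ring

theorem metricMatrix_det_pos (g : SmoothMetric m M) (he : IsSmoothChart e) (hy : y ∈ e.target) :
    0 < (metricMatrix g e y).det :=
  (metricMatrix_posDef he hy).det_pos

theorem volumeDensity_pos (g : SmoothMetric m M) (he : IsSmoothChart e) (hy : y ∈ e.target) :
    0 < volumeDensity g e y :=
  Real.sqrt_pos.2 (metricMatrix_det_pos g he hy)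

/-- This is the trace of `g⁻¹ g = 1`; the constant `m` of the whole argument originates here. -/
theorem sum_metricMatrix_inv_mul (g : SmoothMetric m M) (he : IsSmoothChart e)
    (hy : y ∈ e.target) :
    ∑ i, ∑ j, (metricMatrix g e y)⁻¹ i j * metricMatrix g e y i j = m := by
  have h := Matrix.nonsing_inv_mul (metricMatrix g e y)
    (isUnit_iff_ne_zero.2 (metricMatrix_det_pos g he hy).ne')
  have h2 := congrArg Matrix.trace h
  rw [Matrix.trace_one, Fintype.card_fin] at h2
  simp only [Matrix.trace, Matrix.diag, Matrix.mul_apply] at h2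
  refine Eq.trans ?_ h2
  exact Finset.sum_congr rfl fun i _ => Finset.sum_congr rfl fun j _ => by
    rw [metricMatrix_comm g e y i j]

section Immersion

variable {φ : M → EuclideanSpace ℝ (Fin (n + 1))}

theorem contDiffOn_comp_chart_symm (he : IsSmoothChart e)
    (hφ : ContMDiff (𝓡 m) (𝓡 (n + 1)) ∞ φ) : ContDiffOn ℝ ∞ (φ ∘ e.symm) e.target :=
  contMDiffOn_iff_contDiffOn.1
    (hφ.comp_contMDiffOn (contMDiffOn_symm_of_mem_maximalAtlas he))

theorem partialD_comp_chart_symm (he : IsSmoothChart e)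
    (hφ : ContMDiff (𝓡 m) (𝓡 (n + 1)) ∞ φ) (hy : y ∈ e.target) (i : Fin m) :
    partialD i (φ ∘ e.symm) y =
      mfderiv (𝓡 m) (𝓡 (n + 1)) φ (e.symm y) (coordVector e i y) := by
  have h := mfderiv_comp y (hφ.mdifferentiable (by simp) (e.symm y))
    ((contMDiffAt_chart_symm he hy).mdifferentiableAt (by simp))
  rw [mfderiv_eq_fderiv] at h
  rw [partialD, h]
  rfl

theorem metricMatrix_eq_inner (he : IsSmoothChart e) (hφ : IsIsometricImmersion g φ)
    (hy : y ∈ e.target) (i j : Fin m) :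
    metricMatrix g e y i j =
      inner ℝ (partialD i (φ ∘ e.symm) y) (partialD j (φ ∘ e.symm) y) := by
  rw [partialD_comp_chart_symm he hφ.1 hy, partialD_comp_chart_symm he hφ.1 hy]
  exact (hφ.2 _ _ _).symm

/-- Smoothness of `gᵢⱼ` is read off from `gᵢⱼ = ⟨∂ᵢφ, ∂ⱼφ⟩`, without going through the bundle
structure of `g`. -/
theorem contDiffOn_metricMatrix (he : IsSmoothChart e) (hφ : IsIsometricImmersion g φ)
    (i j : Fin m) : ContDiffOn ℝ ∞ (fun z => metricMatrix g e z i j) e.target := by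
  have hu := contDiffOn_comp_chart_symm he hφ.1
  exact ((contDiffOn_partialD e.open_target hu i).inner ℝ
    (contDiffOn_partialD e.open_target hu j)).congr
      fun z hz => metricMatrix_eq_inner he hφ hz i j

end Immersion

/-! ### Divergence and nondivergence forms of the Laplacian. -/

section Laplacian

variable {V : Type*} [NormedAddCommGroup V] [NormedSpace ℝ V]

/-- The metric `g` has smooth coefficients in the chart `e`. -/
abbrev SmoothCoeff (g : SmoothMetric m M)
    (e : OpenPartialHomeomorph M (EuclideanSpace ℝ (Fin m))) : Prop :=
  ∀ i j, ContDiffOn ℝ ∞ (fun z => metricMatrix g e z i j) e.target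

theorem contDiffOn_metricMatrix_inv (he : IsSmoothChart e) (hg : SmoothCoeff g e) (i j : Fin m) :
    ContDiffOn ℝ ∞ (fun z => (metricMatrix g e z)⁻¹ i j) e.target :=
  contDiffOn_matrix_inv hg (fun _ hz => (metricMatrix_det_pos g he hz).ne') i j

theorem contDiffOn_volumeDensity (he : IsSmoothChart e) (hg : SmoothCoeff g e) :
    ContDiffOn ℝ ∞ (volumeDensity g e) e.target :=
  (contDiffOn_det hg).sqrt fun _ hz => (metricMatrix_det_pos g he hz).ne'

theorem contDiffOn_christoffel (he : IsSmoothChart e) (hg : SmoothCoeff g e) (k i j : Fin m) :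
    ContDiffOn ℝ ∞ (christoffel g e k i j) e.target :=
  contDiffOn_const.mul <| ContDiffOn.sum fun l _ =>
    (contDiffOn_metricMatrix_inv he hg k l).mul
      (((contDiffOn_partialD e.open_target (hg j l) i).add
        (contDiffOn_partialD e.open_target (hg i l) j)).sub
        (contDiffOn_partialD e.open_target (hg i j) l))

/-- The Laplacian in nondivergence form `gⁱʲ (∂ᵢ∂ⱼF - Γᵏᵢⱼ ∂ₖF)` of a function of the coordinates
of the chart `e`. -/
def coordLaplacian (g : SmoothMetric m M)
    (e : OpenPartialHomeomorph M (EuclideanSpace ℝ (Fin m)))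
    (F : EuclideanSpace ℝ (Fin m) → V) (y : EuclideanSpace ℝ (Fin m)) : V :=
  ∑ i, ∑ j, (metricMatrix g e y)⁻¹ i j •
    (partialD i (partialD j F) y - ∑ k, christoffel g e k i j y • partialD k F y)

theorem contDiffOn_coordLaplacian (he : IsSmoothChart e) (hg : SmoothCoeff g e)
    {F : EuclideanSpace ℝ (Fin m) → V} (hF : ContDiffOn ℝ ∞ F e.target) :
    ContDiffOn ℝ ∞ (coordLaplacian g e F) e.target :=
  ContDiffOn.sum fun i _ => ContDiffOn.sum fun j _ =>
    (contDiffOn_metricMatrix_inv he hg i j).smul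
      ((contDiffOn_partialD e.open_target (contDiffOn_partialD e.open_target hF j) i).sub
        (ContDiffOn.sum fun k _ => (contDiffOn_christoffel he hg k i j).smul
          (contDiffOn_partialD e.open_target hF k)))

theorem partialD_volumeDensity (he : IsSmoothChart e) (hg : SmoothCoeff g e) (hy : y ∈ e.target)
    (i : Fin m) :
    partialD i (volumeDensity g e) y = volumeDensity g e y * ((1 / 2 : ℝ) *
      ∑ k, ∑ l, (metricMatrix g e y)⁻¹ k l * partialD i (fun z => metricMatrix g e z l k) y) := by
  have hpos := metricMatrix_det_pos g he hy
  have hd := differentiableAt_of_contDiffOn e.open_target (contDiffOn_det hg) hy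
  have h1 := fderiv_det (fun a b => differentiableAt_of_contDiffOn e.open_target (hg a b) hy)
    hpos.ne' (EuclideanSpace.single i 1)
  have h2 : partialD i (volumeDensity g e) y = (1 / (2 * √(metricMatrix g e y).det)) *
      fderiv ℝ (fun z => (metricMatrix g e z).det) y (EuclideanSpace.single i 1) := by
    rw [partialD, show volumeDensity g e = fun z => √(metricMatrix g e z).det from rfl,
      fderiv_sqrt hd hpos.ne']
    simp
  rw [h2, h1]
  simp only [volumeDensity, partialD]
  set S := ∑ k, ∑ l, (metricMatrix g e y)⁻¹ k l *
    fderiv ℝ (fun z => metricMatrix g e z l k) y (EuclideanSpace.single i 1)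
  have hs : √(metricMatrix g e y).det ≠ 0 := (Real.sqrt_pos.2 hpos).ne'
  -- The second occurrence is the factor `det g` from Jacobi's formula; the first one sits under the
  -- square root.
  nth_rewrite 2 [← Real.mul_self_sqrt hpos.le]
  field_simp

/-- With `I = g⁻¹` and `D l i j = ∂ₗgᵢⱼ` this is the index algebra behind `∂ᵢ(√det g gⁱʲ) = -√det g
gⁱᵏ Γʲᵢₖ`. Everything reduces to contractions of `I I D`; the two with a derivative index contracted
against the free-standing `I i k` agree by symmetry. -/
theorem christoffel_contraction_identity {ι : Type*} [Fintype ι] (I : ι → ι → ℝ)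
    (D : ι → ι → ι → ℝ) (hI : ∀ i j, I i j = I j i) (hD : ∀ l i j, D l i j = D l j i) (j : ι) :
    ∑ i, (-(∑ a, ∑ b, I i a * D i a b * I b j) + ((1 / 2 : ℝ) * ∑ k, ∑ l, I k l * D i l k) * I i j)
      = -∑ i, ∑ k, I i k * ((1 / 2 : ℝ) * ∑ l, I j l * (D i k l + D k i l - D l i k)) := by
  have e1 : ∑ i, ∑ k, ∑ l, I i k * I j l * D k i l = ∑ i, ∑ k, ∑ l, I i k * I j l * D i k l := by
    rw [Finset.sum_comm]
    exact Finset.sum_congr rfl fun i _ => Finset.sum_congr rfl fun k _ => by rw [hI k i]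
  have e2 : ∑ i, ∑ a, ∑ b, I i a * D i a b * I b j = ∑ i, ∑ k, ∑ l, I i k * I j l * D i k l :=
    Finset.sum_congr rfl fun i _ => Finset.sum_congr rfl fun k _ =>
      Finset.sum_congr rfl fun l _ => by rw [hI l j]; ring
  have e3 : ∑ i, (∑ k, ∑ l, I k l * D i l k) * I i j =
      ∑ i, ∑ k, ∑ l, I i k * I j l * D l i k := by
    simp only [Finset.sum_mul]
    rw [Finset.sum_comm]
    refine Finset.sum_congr rfl fun k _ => ?_
    rw [Finset.sum_comm]
    exact Finset.sum_congr rfl fun l _ => Finset.sum_congr rfl fun i _ => by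
      rw [hI i j, hD i l k]; ring
  have e4 : ∑ i, ∑ k, I i k * ((1 / 2 : ℝ) * ∑ l, I j l * (D i k l + D k i l - D l i k)) =
      (1 / 2) * (∑ i, ∑ k, ∑ l, I i k * I j l * D i k l + ∑ i, ∑ k, ∑ l, I i k * I j l * D k i l
        - ∑ i, ∑ k, ∑ l, I i k * I j l * D l i k) := by
    simp only [← Finset.sum_add_distrib, ← Finset.sum_sub_distrib, Finset.mul_sum]
    exact Finset.sum_congr rfl fun i _ => Finset.sum_congr rfl fun k _ =>
      Finset.sum_congr rfl fun l _ => by ring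
  rw [e4, e1, Finset.sum_add_distrib, Finset.sum_neg_distrib, e2]
  simp only [mul_assoc (1 / 2 : ℝ), ← Finset.mul_sum]
  rw [e3]
  ring

theorem sum_partialD_density_mul_inv (he : IsSmoothChart e) (hg : SmoothCoeff g e)
    (hy : y ∈ e.target) (j : Fin m) :
    ∑ i, partialD i (fun z => volumeDensity g e z * (metricMatrix g e z)⁻¹ i j) y =
      -(volumeDensity g e y *
        ∑ i, ∑ k, (metricMatrix g e y)⁻¹ i k * christoffel g e j i k y) := by
  have h := christoffel_contraction_identity (fun i j => (metricMatrix g e y)⁻¹ i j)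
    (fun l i j => partialD l (fun z => metricMatrix g e z i j) y)
    (metricMatrix_inv_comm g e y)
    (fun l i j => by simp only [metricMatrix_comm g e _ i j]) j
  simp only [christoffel]
  rw [← mul_neg, ← h, Finset.mul_sum]
  refine Finset.sum_congr rfl fun i _ => ?_
  rw [partialD_mul i (differentiableAt_of_contDiffOn e.open_target
    (contDiffOn_volumeDensity he hg) hy) (differentiableAt_of_contDiffOn e.open_target
    (contDiffOn_metricMatrix_inv he hg i j) hy), partialD_volumeDensity he hg hy]
  have h2 : partialD i (fun z => (metricMatrix g e z)⁻¹ i j) y = _ :=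
    fderiv_matrix_inv e.open_target hg (fun z hz => (metricMatrix_det_pos g he hz).ne') hy
      (EuclideanSpace.single i 1) i j
  rw [h2]
  simp only [partialD]
  ring

/-- By the product rule the second-order terms match at once, and the derivatives of `√det g gⁱʲ`
supply exactly the Christoffel terms. -/
theorem sum_partialD_density_smul (he : IsSmoothChart e) (hg : SmoothCoeff g e)
    {F : EuclideanSpace ℝ (Fin m) → V} (hF : ContDiffOn ℝ ∞ F e.target) (hy : y ∈ e.target) :
    ∑ i, partialD i (fun z => volumeDensity g e z •
      ∑ j, (metricMatrix g e z)⁻¹ i j • partialD j F z) y =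
        volumeDensity g e y • coordLaplacian g e F y := by
  have hU := e.open_target
  have dP := fun j => contDiffOn_partialD hU hF j
  have dwI := fun i j => (contDiffOn_volumeDensity he hg).mul (contDiffOn_metricMatrix_inv he hg i j)
  have h1 : ∀ i, partialD i (fun z => volumeDensity g e z •
      ∑ j, (metricMatrix g e z)⁻¹ i j • partialD j F z) y =
      ∑ j, ((volumeDensity g e y * (metricMatrix g e y)⁻¹ i j) • partialD i (partialD j F) y +
        partialD i (fun z => volumeDensity g e z * (metricMatrix g e z)⁻¹ i j) y •
          partialD j F y) := fun i => by
    simp only [Finset.smul_sum, smul_smul]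
    rw [partialD_sum _ i fun j _ =>
      (differentiableAt_of_contDiffOn hU (dwI i j) hy).fun_smul
        (differentiableAt_of_contDiffOn hU (dP j) hy)]
    exact Finset.sum_congr rfl fun j _ => partialD_smul i
      (differentiableAt_of_contDiffOn hU (dwI i j) hy) (differentiableAt_of_contDiffOn hU (dP j) hy)
  simp only [h1, Finset.sum_add_distrib]
  have h2 : ∑ i, ∑ j, partialD i (fun z => volumeDensity g e z * (metricMatrix g e z)⁻¹ i j) y •
      partialD j F y = -(volumeDensity g e y • ∑ i, ∑ j, (metricMatrix g e y)⁻¹ i j •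
        ∑ k, christoffel g e k i j y • partialD k F y) := by
    rw [Finset.sum_comm]
    simp only [← Finset.sum_smul, sum_partialD_density_mul_inv he hg hy]
    simp only [neg_smul, Finset.sum_neg_distrib, mul_smul, ← Finset.smul_sum, Finset.sum_smul]
    congr 2
    rw [Finset.sum_comm]
    refine Finset.sum_congr rfl fun i _ => ?_
    rw [Finset.sum_comm]
    refine Finset.sum_congr rfl fun j _ => ?_
    simp only [Finset.smul_sum]
  rw [h2]
  simp only [coordLaplacian, smul_sub, Finset.sum_sub_distrib, Finset.smul_sum, smul_smul]
  abel

theorem chartLaplacian_eq_coordLaplacian (he : IsSmoothChart e) (hg : SmoothCoeff g e)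
    {f : M → V} (hf : ContDiffOn ℝ ∞ (f ∘ e.symm) e.target) (hy : y ∈ e.target) :
    chartLaplacian g e f y = coordLaplacian g e (f ∘ e.symm) y := by
  rw [chartLaplacian, sum_partialD_density_smul he hg hf hy,
    inv_smul_smul₀ (volumeDensity_pos g he hy).ne']

end Laplacian

end Chart

/-! ### Green's formula in a chart. -/

section Green

open MeasureTheory

variable {m : ℕ}

theorem integrable_partialD {F : EuclideanSpace ℝ (Fin m) → ℝ} (hF : ContDiff ℝ 1 F)
    (hc : HasCompactSupport F) (i : Fin m) : Integrable (partialD i F) :=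
  Continuous.integrable_of_hasCompactSupport
    ((hF.continuous_fderiv (by simp)).clm_apply continuous_const) (hc.fderiv_apply ℝ _)

/-- Integration by parts against the constant function `1`. -/
theorem integral_partialD_eq_zero {F : EuclideanSpace ℝ (Fin m) → ℝ} (hF : ContDiff ℝ 1 F)
    (hc : HasCompactSupport F) (i : Fin m) : ∫ y, partialD i F y = 0 := by
  have hd := hF.differentiable (by simp)
  have h := integral_mul_fderiv_eq_neg_fderiv_mul_of_integrable (μ := volume)
    (f := fun _ : EuclideanSpace ℝ (Fin m) => (1 : ℝ)) (g := F)
    (v := EuclideanSpace.single i 1) (by simp)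
    (by simpa using! integrable_partialD hF hc i)
    (by simpa using! hF.continuous.integrable_of_hasCompactSupport hc)
    (fun x _ => by fun_prop) (fun x _ => hd x)
  simpa using! h

theorem contDiff_of_contDiffOn_of_eqOn_zero {E' V : Type*} [NormedAddCommGroup E']
    [NormedSpace ℝ E'] [NormedAddCommGroup V] [NormedSpace ℝ V] {k : WithTop ℕ∞} {U K : Set E'}
    {F : E' → V} (hU : IsOpen U) (hK : IsClosed K) (hKU : K ⊆ U) (hF : ContDiffOn ℝ k F U)
    (h0 : ∀ x ∉ K, F x = 0) : ContDiff ℝ k F := by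
  rw [contDiff_iff_contDiffAt]
  intro x
  by_cases hx : x ∈ U
  · exact hF.contDiffAt (hU.mem_nhds hx)
  · have : F =ᶠ[nhds x] fun _ => 0 := by
      filter_upwards [hK.isOpen_compl.mem_nhds fun h => hx (hKU h)] with z hz using h0 z hz
    exact contDiffAt_const.congr_of_eventuallyEq this

variable {M : Type*} [TopologicalSpace M]
  [ChartedSpace (EuclideanSpace ℝ (Fin m)) M] [IsManifold (𝓡 m) ∞ M]
  {g : SmoothMetric m M} {e : OpenPartialHomeomorph M (EuclideanSpace ℝ (Fin m))}
  {V : Type*} [NormedAddCommGroup V] [InnerProductSpace ℝ V]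

theorem partialD_eq_zero_of_notMem_tsupport {W : Type*} [NormedAddCommGroup W] [NormedSpace ℝ W]
    {F : EuclideanSpace ℝ (Fin m) → W} {y : EuclideanSpace ℝ (Fin m)} (hy : y ∉ tsupport F)
    (i : Fin m) : partialD i F y = 0 := by
  have : F =ᶠ[nhds y] 0 := notMem_tsupport_iff_eventuallyEq.1 hy
  rw [partialD, this.fderiv_eq]
  simp

theorem tsupport_partialD_subset {W : Type*} [NormedAddCommGroup W] [NormedSpace ℝ W]
    (F : EuclideanSpace ℝ (Fin m) → W) (i : Fin m) : tsupport (partialD i F) ⊆ tsupport F :=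
  closure_minimal (fun _ hy => by_contra fun h => hy (partialD_eq_zero_of_notMem_tsupport h i))
    (isClosed_tsupport F)

theorem coordLaplacian_eq_zero_of_notMem_tsupport {F : EuclideanSpace ℝ (Fin m) → V}
    {y : EuclideanSpace ℝ (Fin m)} (hy : y ∉ tsupport F) : coordLaplacian g e F y = 0 := by
  refine Finset.sum_eq_zero fun i _ => Finset.sum_eq_zero fun j _ => ?_
  rw [partialD_eq_zero_of_notMem_tsupport (fun h => hy (tsupport_partialD_subset F j h))]
  simp [partialD_eq_zero_of_notMem_tsupport hy]

/-- The integrand is the coordinate divergence of `Zⁱ = √det g gⁱʲ (⟨F, ∂ⱼζ⟩ - ⟨∂ⱼF, ζ⟩)`, which is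
compactly supported because `ζ` is. `F` need only be smooth on the chart domain. -/
theorem coordLaplacian_symmetric (he : IsSmoothChart e) (hg : SmoothCoeff g e)
    {F ζ : EuclideanSpace ℝ (Fin m) → V} (hF : ContDiffOn ℝ ∞ F e.target)
    (hζ : ContDiffOn ℝ ∞ ζ e.target) (hc : HasCompactSupport ζ) (hs : tsupport ζ ⊆ e.target) :
    Integrable (fun y => (inner ℝ (F y) (coordLaplacian g e ζ y) -
        inner ℝ (coordLaplacian g e F y) (ζ y)) * volumeDensity g e y) ∧
      ∫ y, (inner ℝ (F y) (coordLaplacian g e ζ y) -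
        inner ℝ (coordLaplacian g e F y) (ζ y)) * volumeDensity g e y = 0 := by
  have hU := e.open_target
  set X : (EuclideanSpace ℝ (Fin m) → V) → Fin m → EuclideanSpace ℝ (Fin m) → V :=
    fun f i z => volumeDensity g e z • ∑ j, (metricMatrix g e z)⁻¹ i j • partialD j f z with hX
  have hXs : ∀ f, ContDiffOn ℝ ∞ f e.target → ∀ i, ContDiffOn ℝ ∞ (X f i) e.target :=
    fun f hf i => (contDiffOn_volumeDensity he hg).smul <| ContDiffOn.sum fun j _ =>
      (contDiffOn_metricMatrix_inv he hg i j).smul (contDiffOn_partialD hU hf j)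
  set Z : Fin m → EuclideanSpace ℝ (Fin m) → ℝ :=
    fun i z => inner ℝ (F z) (X ζ i z) - inner ℝ (X F i z) (ζ z) with hZ
  have hZ0 : ∀ i, ∀ y ∉ tsupport ζ, Z i y = 0 := fun i y hy => by
    simp [hZ, hX, partialD_eq_zero_of_notMem_tsupport hy, image_eq_zero_of_notMem_tsupport hy]
  have hZs : ∀ i, ContDiff ℝ 1 (Z i) := fun i =>
    contDiff_of_contDiffOn_of_eqOn_zero hU (isClosed_tsupport ζ) hs
      (((hF.inner ℝ (hXs ζ hζ i)).sub ((hXs F hF i).inner ℝ hζ)).of_le (by simp)) (hZ0 i)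
  have hZc : ∀ i, HasCompactSupport (Z i) := fun i =>
    hc.mono' fun y hy => by_contra fun h => hy (hZ0 i y h)
  have hZt : ∀ i, tsupport (Z i) ⊆ tsupport ζ := fun i =>
    closure_minimal (fun z hz => by_contra fun h => hz (hZ0 i z h)) (isClosed_tsupport ζ)
  have hsum : (fun y => (inner ℝ (F y) (coordLaplacian g e ζ y) -
      inner ℝ (coordLaplacian g e F y) (ζ y)) * volumeDensity g e y) =
      fun y => ∑ i, partialD i (Z i) y := by
    funext y
    by_cases hy : y ∈ e.target
    · have d := fun {f : EuclideanSpace ℝ (Fin m) → V} (hf : ContDiffOn ℝ ∞ f e.target) =>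
        differentiableAt_of_contDiffOn hU hf hy
      have h1 : ∀ i, partialD i (Z i) y =
          (inner ℝ (F y) (partialD i (X ζ i) y) + inner ℝ (partialD i F y) (X ζ i y)) -
          (inner ℝ (X F i y) (partialD i ζ y) + inner ℝ (partialD i (X F i) y) (ζ y)) := fun i => by
        rw [← partialD_inner i (d hF) (d (hXs ζ hζ i)), ← partialD_inner i (d (hXs F hF i)) (d hζ)]
        simp only [partialD, hZ]
        rw [fderiv_fun_sub ((d hF).inner ℝ (d (hXs ζ hζ i))) ((d (hXs F hF i)).inner ℝ (d hζ))]
        rfl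
      -- The terms with one derivative on each factor cancel because `g⁻¹` is symmetric.
      have h2 : ∑ i, inner ℝ (partialD i F y) (X ζ i y) =
          ∑ i, inner ℝ (X F i y) (partialD i ζ y) := by
        simp only [hX, inner_smul_left, inner_smul_right, inner_sum, sum_inner, Finset.mul_sum]
        rw [Finset.sum_comm]
        exact Finset.sum_congr rfl fun i _ => Finset.sum_congr rfl fun j _ => by
          rw [metricMatrix_inv_comm g e y i j]; simp
      simp only [h1, Finset.sum_add_distrib, Finset.sum_sub_distrib]
      rw [h2, ← inner_sum, ← sum_inner, sum_partialD_density_smul he hg hζ hy,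
        sum_partialD_density_smul he hg hF hy, inner_smul_left, inner_smul_right]
      simp
      ring
    · have hy' : y ∉ tsupport ζ := fun h => hy (hs h)
      rw [coordLaplacian_eq_zero_of_notMem_tsupport hy', image_eq_zero_of_notMem_tsupport hy']
      rw [Finset.sum_eq_zero fun i _ => ?_]
      · simp
      · exact partialD_eq_zero_of_notMem_tsupport (fun h => hy' (hZt i h)) i
  rw [hsum]
  refine ⟨integrable_finsetSum _ fun i _ => integrable_partialD (hZs i) (hZc i) i, ?_⟩
  rw [integral_finsetSum _ fun i _ => integrable_partialD (hZs i) (hZc i) i]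
  exact Finset.sum_eq_zero fun i _ => integral_partialD_eq_zero (hZs i) (hZc i) i

end Green

/-! ### Differentiation in the parameter of a one-parameter family. -/

section Slice

open MeasureTheory

variable {m : ℕ} {V : Type*} [NormedAddCommGroup V] [NormedSpace ℝ V]
  {U : Set (EuclideanSpace ℝ (Fin m))} {Q : ℝ × EuclideanSpace ℝ (Fin m) → V}

theorem hasFDerivAt_of_contDiffOn_cylinder (hU : IsOpen U)
    (hQ : ContDiffOn ℝ ∞ Q (Set.univ ×ˢ U)) {t : ℝ} {y : EuclideanSpace ℝ (Fin m)} (hy : y ∈ U) :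
    HasFDerivAt Q (fderiv ℝ Q (t, y)) (t, y) :=
  (differentiableAt_of_contDiffOn (isOpen_univ.prod hU) hQ ⟨trivial, hy⟩).hasFDerivAt

theorem hasDerivAt_slice (hU : IsOpen U) (hQ : ContDiffOn ℝ ∞ Q (Set.univ ×ˢ U)) (t : ℝ)
    {y : EuclideanSpace ℝ (Fin m)} (hy : y ∈ U) :
    HasDerivAt (fun s => Q (s, y)) (fderiv ℝ Q (t, y) (1, 0)) t :=
  (hasFDerivAt_of_contDiffOn_cylinder hU hQ hy).comp_hasDerivAt t
    ((hasDerivAt_id t).prodMk (hasDerivAt_const t y))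

theorem partialD_slice (hU : IsOpen U) (hQ : ContDiffOn ℝ ∞ Q (Set.univ ×ˢ U)) (t : ℝ)
    {y : EuclideanSpace ℝ (Fin m)} (hy : y ∈ U) (i : Fin m) :
    partialD i (fun z => Q (t, z)) y = fderiv ℝ Q (t, y) (0, EuclideanSpace.single i 1) := by
  have h : HasFDerivAt (fun z => Q (t, z)) _ y :=
    (hasFDerivAt_of_contDiffOn_cylinder hU hQ hy).comp y (hasFDerivAt_prodMk_right t y)
  rw [partialD, h.fderiv]
  rfl

theorem contDiffOn_fderiv_apply_cylinder (hU : IsOpen U)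
    (hQ : ContDiffOn ℝ ∞ Q (Set.univ ×ˢ U)) (v : ℝ × EuclideanSpace ℝ (Fin m)) :
    ContDiffOn ℝ ∞ (fun p => fderiv ℝ Q p v) (Set.univ ×ˢ U) :=
  (hQ.fderiv_of_isOpen (isOpen_univ.prod hU) (m := ∞) (by simp)).clm_apply contDiffOn_const

theorem contDiffOn_partialD_slice (hU : IsOpen U) (hQ : ContDiffOn ℝ ∞ Q (Set.univ ×ˢ U))
    (i : Fin m) :
    ContDiffOn ℝ ∞ (fun p : ℝ × EuclideanSpace ℝ (Fin m) =>
      partialD i (fun z => Q (p.1, z)) p.2) (Set.univ ×ˢ U) :=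
  (contDiffOn_fderiv_apply_cylinder hU hQ (0, EuclideanSpace.single i 1)).congr
    fun p hp => partialD_slice hU hQ p.1 hp.2 i

theorem contDiffOn_deriv_slice (hU : IsOpen U) (hQ : ContDiffOn ℝ ∞ Q (Set.univ ×ˢ U)) :
    ContDiffOn ℝ ∞ (fun p : ℝ × EuclideanSpace ℝ (Fin m) =>
      deriv (fun s => Q (s, p.2)) p.1) (Set.univ ×ˢ U) :=
  (contDiffOn_fderiv_apply_cylinder hU hQ (1, 0)).congr
    fun p hp => (hasDerivAt_slice hU hQ p.1 hp.2).deriv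

theorem fderiv_fderiv_apply_cylinder (hU : IsOpen U) (hQ : ContDiffOn ℝ ∞ Q (Set.univ ×ˢ U))
    (t : ℝ) {y : EuclideanSpace ℝ (Fin m)} (hy : y ∈ U) (v w : ℝ × EuclideanSpace ℝ (Fin m)) :
    fderiv ℝ (fun p => fderiv ℝ Q p v) (t, y) w = fderiv ℝ (fderiv ℝ Q) (t, y) w v := by
  have hd : DifferentiableAt ℝ (fderiv ℝ Q) (t, y) :=
    differentiableAt_of_contDiffOn (isOpen_univ.prod hU)
      (hQ.fderiv_of_isOpen (isOpen_univ.prod hU) (m := ∞) (by simp)) ⟨trivial, hy⟩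
  rw [fderiv_clm_apply hd (by fun_prop)]
  simp

/-- `∂ₜ` and `∂ᵢ` commute by symmetry of the second derivative on the open cylinder `ℝ × U`. -/
theorem hasDerivAt_partialD_slice (hU : IsOpen U) (hQ : ContDiffOn ℝ ∞ Q (Set.univ ×ˢ U))
    (t : ℝ) {y : EuclideanSpace ℝ (Fin m)} (hy : y ∈ U) (i : Fin m) :
    HasDerivAt (fun s => partialD i (fun z => Q (s, z)) y)
      (partialD i (fun z => deriv (fun s => Q (s, z)) t) y) t := by
  have hs : IsSymmSndFDerivAt ℝ Q (t, y) :=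
    (hQ.contDiffAt ((isOpen_univ.prod hU).mem_nhds ⟨trivial, hy⟩)).isSymmSndFDerivAt
      (by simpa using WithTop.coe_le_coe.2 (le_top : (2 : ℕ∞) ≤ ⊤))
  have h1 := hasDerivAt_slice hU
    (contDiffOn_fderiv_apply_cylinder hU hQ (0, EuclideanSpace.single i 1)) t hy
  rw [fderiv_fderiv_apply_cylinder hU hQ t hy, hs,
    ← fderiv_fderiv_apply_cylinder hU hQ t hy,
    ← partialD_slice hU (contDiffOn_fderiv_apply_cylinder hU hQ (1, 0)) t hy i,
    ← partialD_eqOn hU (fun z hz => (hasDerivAt_slice hU hQ t hz).deriv) i hy] at h1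
  exact h1.congr_of_eventuallyEq (Filter.Eventually.of_forall fun s => partialD_slice hU hQ s hy i)

theorem hasDerivAt_partialD_partialD_slice (hU : IsOpen U)
    (hQ : ContDiffOn ℝ ∞ Q (Set.univ ×ˢ U)) (t : ℝ) {y : EuclideanSpace ℝ (Fin m)} (hy : y ∈ U)
    (i j : Fin m) :
    HasDerivAt (fun s => partialD i (partialD j (fun z => Q (s, z))) y)
      (partialD i (partialD j (fun z => deriv (fun s => Q (s, z)) t)) y) t := by
  have h := hasDerivAt_partialD_slice hU (contDiffOn_partialD_slice hU hQ j) t hy i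
  rwa [partialD_eqOn hU (fun z hz => (hasDerivAt_partialD_slice hU hQ t hz j).deriv) i hy] at h

/-- Dominated convergence applies: `∂ₜF` is bounded on the compact set `[t - 1, t + 1] × B`. -/
theorem hasDerivAt_setIntegral_slice {F : ℝ × EuclideanSpace ℝ (Fin m) → ℝ} (hU : IsOpen U)
    (hF : ContDiffOn ℝ ∞ F (Set.univ ×ˢ U)) {B : Set (EuclideanSpace ℝ (Fin m))}
    (hB : IsCompact B) (hBU : B ⊆ U) (t : ℝ) :
    HasDerivAt (fun s => ∫ y in B, F (s, y)) (∫ y in B, deriv (fun s => F (s, y)) t) t := by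
  have hD := contDiffOn_deriv_slice hU hF
  have hcyl : Set.Icc (t - 1) (t + 1) ×ˢ B ⊆ (Set.univ : Set ℝ) ×ˢ U :=
    Set.prod_mono (Set.subset_univ _) hBU
  obtain ⟨C, hC⟩ := (isCompact_Icc.prod hB).exists_bound_of_continuousOn (hD.continuousOn.mono hcyl)
  have hsl : ∀ s : ℝ, ∀ {G : ℝ × EuclideanSpace ℝ (Fin m) → ℝ},
      ContDiffOn ℝ ∞ G (Set.univ ×ˢ U) → ContinuousOn (fun y => G (s, y)) B := fun s G hG =>
    hG.continuousOn.comp (by fun_prop) fun y hy => ⟨trivial, hBU hy⟩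
  refine (hasDerivAt_integral_of_dominated_loc_of_deriv_le (μ := volume.restrict B)
    (F := fun s y => F (s, y)) (F' := fun s y => deriv (fun s => F (s, y)) s)
    (s := Set.Icc (t - 1) (t + 1)) (bound := fun _ => C)
    (Icc_mem_nhds (by linarith) (by linarith))
    (Filter.Eventually.of_forall fun s => (hsl s hF).aestronglyMeasurable hB.measurableSet)
    ((hsl t hF).integrableOn_compact hB)
    ((hsl t hD).aestronglyMeasurable hB.measurableSet) ?_ ?_ ?_).2
  · exact (ae_restrict_iff' hB.measurableSet).2
      (Filter.Eventually.of_forall fun y hy s hs => hC (s, y) ⟨hs, hy⟩)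
  · exact integrableOn_const hB.measure_lt_top.ne
  · exact (ae_restrict_iff' hB.measurableSet).2 (Filter.Eventually.of_forall fun y hy s _ =>
      (hasDerivAt_slice hU hF s (hBU hy)).differentiableAt.hasDerivAt)

end Slice

/-! ### First variation of the bienergy. -/

section FirstVariation

variable {m n : ℕ} {M : Type*} [TopologicalSpace M]
  [ChartedSpace (EuclideanSpace ℝ (Fin m)) M] [IsManifold (𝓡 m) ∞ M]
  {g : SmoothMetric m M} {e : OpenPartialHomeomorph M (EuclideanSpace ℝ (Fin m))}
  {y : EuclideanSpace ℝ (Fin m)} {φ : M → EuclideanSpace ℝ (Fin (n + 1))}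

theorem contDiffOn_coordLaplacian_slice {V : Type*} [NormedAddCommGroup V] [NormedSpace ℝ V]
    {Q : ℝ × EuclideanSpace ℝ (Fin m) → V} (he : IsSmoothChart e) (hg : SmoothCoeff g e)
    (hQ : ContDiffOn ℝ ∞ Q (Set.univ ×ˢ e.target)) :
    ContDiffOn ℝ ∞ (fun p : ℝ × EuclideanSpace ℝ (Fin m) =>
      coordLaplacian g e (fun z => Q (p.1, z)) p.2) (Set.univ ×ˢ e.target) := by
  have hU := e.open_target
  have hsnd : ContDiffOn ℝ ∞ (Prod.snd : ℝ × EuclideanSpace ℝ (Fin m) → _)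
    (Set.univ ×ˢ e.target) := contDiffOn_snd
  have hmaps : Set.MapsTo (Prod.snd : ℝ × EuclideanSpace ℝ (Fin m) → _)
    (Set.univ ×ˢ e.target) e.target := fun p hp => hp.2
  exact ContDiffOn.sum fun i _ => ContDiffOn.sum fun j _ =>
    ((contDiffOn_metricMatrix_inv he hg i j).comp hsnd hmaps).smul
      ((contDiffOn_partialD_slice hU (contDiffOn_partialD_slice hU hQ j) i).sub
        (ContDiffOn.sum fun k _ => ((contDiffOn_christoffel he hg k i j).comp hsnd hmaps).smul
          (contDiffOn_partialD_slice hU hQ k)))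

theorem hasDerivAt_coordLaplacian_slice {V : Type*} [NormedAddCommGroup V] [NormedSpace ℝ V]
    {Q : ℝ × EuclideanSpace ℝ (Fin m) → V}
    (hQ : ContDiffOn ℝ ∞ Q (Set.univ ×ˢ e.target)) (t : ℝ) (hy : y ∈ e.target) :
    HasDerivAt (fun s => coordLaplacian g e (fun z => Q (s, z)) y)
      (coordLaplacian g e (fun z => deriv (fun s => Q (s, z)) t) y) t :=
  HasDerivAt.fun_sum fun i _ => HasDerivAt.fun_sum fun j _ => HasDerivAt.const_smul _ <|
    (hasDerivAt_partialD_partialD_slice e.open_target hQ t hy i j).sub <|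
      HasDerivAt.fun_sum fun k _ =>
        (hasDerivAt_partialD_slice e.open_target hQ t hy k).const_smul _

/-- The projection only removes the component along `ψ`. No constraint on `ψ` is needed, so this
applies to every map of a variation. -/
theorem tensionField_eq (ψ : M → EuclideanSpace ℝ (Fin (n + 1))) :
    tensionField g e ψ y = coordLaplacian g e (ψ ∘ e.symm) y -
      (∑ i, ∑ j, (metricMatrix g e y)⁻¹ i j *
        inner ℝ (ψ (e.symm y)) (partialD i (partialD j (ψ ∘ e.symm)) y)) • ψ (e.symm y) := by
  simp only [tensionField, nablaD, sphereTangentProj, coordLaplacian, Finset.sum_smul,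
    ← Finset.sum_sub_distrib]
  refine Finset.sum_congr rfl fun i _ => Finset.sum_congr rfl fun j _ => ?_
  rw [mul_smul, ← smul_sub]
  congr 1
  abel

theorem inner_partialD_of_mem_sphere {u : EuclideanSpace ℝ (Fin m) → EuclideanSpace ℝ (Fin (n + 1))}
    {U : Set (EuclideanSpace ℝ (Fin m))} (hU : IsOpen U) (hu : ContDiffOn ℝ ∞ u U)
    (h1 : ∀ z ∈ U, ‖u z‖ = 1) (hy : y ∈ U) (i : Fin m) : inner ℝ (u y) (partialD i u y) = 0 := by
  have d := differentiableAt_of_contDiffOn hU hu hy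
  have h := partialD_inner i d d
  have h2 : Set.EqOn (fun z => inner ℝ (u z) (u z)) (fun _ => (1 : ℝ)) U := fun z hz => by
    simp [h1 z hz]
  rw [partialD_eqOn hU h2 i hy, partialD_const, real_inner_comm (u y)] at h
  linarith

theorem inner_partialD_partialD_of_mem_sphere
    {u : EuclideanSpace ℝ (Fin m) → EuclideanSpace ℝ (Fin (n + 1))}
    {U : Set (EuclideanSpace ℝ (Fin m))} (hU : IsOpen U) (hu : ContDiffOn ℝ ∞ u U)
    (h1 : ∀ z ∈ U, ‖u z‖ = 1) (hy : y ∈ U) (i j : Fin m) :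
    inner ℝ (u y) (partialD i (partialD j u) y) = -inner ℝ (partialD i u y) (partialD j u y) := by
  have h := partialD_inner i (differentiableAt_of_contDiffOn hU hu hy)
    (differentiableAt_of_contDiffOn hU (contDiffOn_partialD hU hu j) hy)
  rw [partialD_eqOn hU (fun z hz => inner_partialD_of_mem_sphere hU hu h1 hz j) i hy,
    partialD_const] at h
  linarith

theorem sum_inv_mul_inner_partialD_partialD (he : IsSmoothChart e) (hφ : IsIsometricImmersion g φ)
    (h1 : ∀ x, ‖φ x‖ = 1) (hy : y ∈ e.target) :
    ∑ i, ∑ j, (metricMatrix g e y)⁻¹ i j *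
      inner ℝ (φ (e.symm y)) (partialD i (partialD j (φ ∘ e.symm)) y) = -m := by
  rw [← sum_metricMatrix_inv_mul g he hy]
  simp only [← Finset.sum_neg_distrib]
  refine Finset.sum_congr rfl fun i _ => Finset.sum_congr rfl fun j _ => ?_
  have := inner_partialD_partialD_of_mem_sphere e.open_target
    (contDiffOn_comp_chart_symm he hφ.1) (fun z _ => h1 (e.symm z)) hy i j
  rw [Function.comp_apply] at this
  rw [this, metricMatrix_eq_inner he hφ hy, mul_neg]

theorem tensionField_of_isometricImmersion (he : IsSmoothChart e) (hφ : IsIsometricImmersion g φ)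
    (h1 : ∀ x, ‖φ x‖ = 1) (hy : y ∈ e.target) :
    tensionField g e φ y = coordLaplacian g e (φ ∘ e.symm) y + (m : ℝ) • φ (e.symm y) := by
  rw [tensionField_eq, sum_inv_mul_inner_partialD_partialD he hφ h1 hy]
  simp

theorem inner_tensionField (he : IsSmoothChart e) (hφ : IsIsometricImmersion g φ)
    (h1 : ∀ x, ‖φ x‖ = 1) (hy : y ∈ e.target) :
    inner ℝ (φ (e.symm y)) (tensionField g e φ y) = 0 := by
  have h0 : ∀ k, inner ℝ (φ (e.symm y)) (partialD k (φ ∘ e.symm) y) = 0 := fun k =>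
    inner_partialD_of_mem_sphere e.open_target
      (contDiffOn_comp_chart_symm he hφ.1) (fun z _ => h1 (e.symm z)) hy k
  simp [tensionField, nablaD, sphereTangentProj, inner_sum, inner_smul_right, inner_sub_right, h0,
    h1]

theorem contDiffOn_tensionField (he : IsSmoothChart e) (hφ : IsIsometricImmersion g φ)
    (h1 : ∀ x, ‖φ x‖ = 1) : ContDiffOn ℝ ∞ (tensionField g e φ) e.target :=
  have hu := contDiffOn_comp_chart_symm he hφ.1
  ((contDiffOn_coordLaplacian he (contDiffOn_metricMatrix he hφ) hu).add
    (hu.const_smul (m : ℝ))).congr fun _ hz => tensionField_of_isometricImmersion he hφ h1 hz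

/-- Write `τ(Ψₜ) = ΔΨₜ - aₜΨₜ`, where `aₜ` is the trace of `⟨Ψₜ, ∂ᵢ∂ⱼΨₜ⟩`. With `V` the velocity,
the derivative at `0` is `ΔV + mV - a₀'φ`, since `a₀ = -m`; the last term drops out on pairing with
`τ ⟂ φ`, so `a₀'` is never computed. -/
theorem hasDerivAt_bienergyOn (he : IsSmoothChart e) (hφ : IsIsometricImmersion g φ)
    (h1 : ∀ x, ‖φ x‖ = 1) {K : Set M} (hK : IsCompact K) (hKe : K ⊆ e.source)
    {Ψ : ℝ → M → EuclideanSpace ℝ (Fin (n + 1))} (hΨ : IsSphereVariation m φ K Ψ) :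
    HasDerivAt (fun t => bienergyOn g e K (Ψ t))
      (∫ y in e '' K, (inner ℝ (tensionField g e φ y)
          (coordLaplacian g e (fun z => deriv (fun t => Ψ t (e.symm z)) 0) y) +
        m * inner ℝ (tensionField g e φ y) (deriv (fun t => Ψ t (e.symm y)) 0)) *
          volumeDensity g e y) 0 := by
  have hU := e.open_target
  have hg : SmoothCoeff g e := contDiffOn_metricMatrix he hφ
  set Q : ℝ × EuclideanSpace ℝ (Fin m) → EuclideanSpace ℝ (Fin (n + 1)) :=
    fun p => Ψ p.1 (e.symm p.2) with hQdef
  have hQ : ContDiffOn ℝ ∞ Q (Set.univ ×ˢ e.target) := by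
    have h2 : ContMDiffOn (𝓘(ℝ, ℝ).prod (𝓡 m)) (𝓘(ℝ, ℝ).prod (𝓡 m)) ∞
        (Prod.map id e.symm) ((Set.univ : Set ℝ) ×ˢ e.target) :=
      contMDiffOn_id.prodMap (contMDiffOn_symm_of_mem_maximalAtlas he)
    have h3 := hΨ.smooth.comp_contMDiffOn h2
    -- The product manifold structure on `ℝ × ℝᵐ` is that of the normed space, so smoothness becomes
    -- `ContDiffOn`.
    rw [← modelWithCornersSelf_prod, chartedSpaceSelf_prod] at h3
    exact contMDiffOn_iff_contDiffOn.1 h3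
  set a : ℝ × EuclideanSpace ℝ (Fin m) → ℝ := fun p => ∑ i, ∑ j,
    (metricMatrix g e p.2)⁻¹ i j *
      inner ℝ (Q p) (partialD i (partialD j (fun z => Q (p.1, z))) p.2) with ha_def
  have hsnd : ContDiffOn ℝ ∞ (Prod.snd : ℝ × EuclideanSpace ℝ (Fin m) → _)
    (Set.univ ×ˢ e.target) := contDiffOn_snd
  have hmaps : Set.MapsTo (Prod.snd : ℝ × EuclideanSpace ℝ (Fin m) → _)
    (Set.univ ×ˢ e.target) e.target := fun p hp => hp.2
  have ha : ContDiffOn ℝ ∞ a (Set.univ ×ˢ e.target) :=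
    ContDiffOn.sum fun i _ => ContDiffOn.sum fun j _ =>
      ((contDiffOn_metricMatrix_inv he hg i j).comp hsnd hmaps).mul
        (hQ.inner ℝ (contDiffOn_partialD_slice hU (contDiffOn_partialD_slice hU hQ j) i))
  have hT : ∀ t y, tensionField g e (Ψ t) y =
      coordLaplacian g e (fun z => Q (t, z)) y - a (t, y) • Q (t, y) := fun t y =>
    tensionField_eq (Ψ t)
  set F : ℝ × EuclideanSpace ℝ (Fin m) → ℝ :=
    fun p => ‖tensionField g e (Ψ p.1) p.2‖ ^ 2 * volumeDensity g e p.2 with hF_def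
  have hTs : ContDiffOn ℝ ∞ (fun p : ℝ × EuclideanSpace ℝ (Fin m) =>
      tensionField g e (Ψ p.1) p.2) (Set.univ ×ˢ e.target) := by
    simp only [hT]
    exact (contDiffOn_coordLaplacian_slice he hg hQ).sub (ha.smul hQ)
  have hF : ContDiffOn ℝ ∞ F (Set.univ ×ˢ e.target) :=
    (hTs.norm_sq ℝ).mul ((contDiffOn_volumeDensity he hg).comp hsnd hmaps)
  have hB : IsCompact (e '' K) := hK.image_of_continuousOn (e.continuousOn.mono hKe)
  have hBU : e '' K ⊆ e.target := by
    rintro _ ⟨x, hx, rfl⟩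
    exact e.map_source (hKe hx)
  have hmain := (hasDerivAt_setIntegral_slice hU hF hB hBU 0).const_mul (1 / 2 : ℝ)
  refine hmain.congr_deriv ?_
  rw [← MeasureTheory.integral_const_mul]
  refine MeasureTheory.setIntegral_congr_fun hB.measurableSet fun y hyB => ?_
  have hy := hBU hyB
  have hQ0 : Q (0, y) = φ (e.symm y) := by simp [hQdef, hΨ.initial]
  have ha0 : a (0, y) = -m := by
    have := sum_inv_mul_inner_partialD_partialD he hφ h1 hy
    rw [← hΨ.initial] at this
    exact this
  have dT : HasDerivAt (fun t => tensionField g e (Ψ t) y)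
      (coordLaplacian g e (fun z => deriv (fun t => Q (t, z)) 0) y -
        (a (0, y) • deriv (fun t => Q (t, y)) 0 +
          deriv (fun t => a (t, y)) 0 • Q (0, y))) 0 := by
    simp only [hT]
    exact (hasDerivAt_coordLaplacian_slice hQ 0 hy).sub
      ((hasDerivAt_slice hU ha 0 hy).differentiableAt.hasDerivAt.smul
        (hasDerivAt_slice hU hQ 0 hy).differentiableAt.hasDerivAt)
  have dF : HasDerivAt (fun t => F (t, y)) _ 0 := dT.norm_sq.mul_const (volumeDensity g e y)
  have ht : inner ℝ (tensionField g e φ y) (φ (e.symm y)) = 0 := by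
    rw [real_inner_comm]; exact inner_tensionField he hφ h1 hy
  rw [dF.deriv, hΨ.initial, ha0, hQ0, inner_sub_right, inner_add_right, inner_smul_right,
    inner_smul_right, ht]
  ring

end FirstVariation

/-! ### Linearity of the Laplacian and variations with prescribed velocity. -/

section Variation

variable {m n : ℕ} {M : Type*} [TopologicalSpace M]
  [ChartedSpace (EuclideanSpace ℝ (Fin m)) M] [IsManifold (𝓡 m) ∞ M]
  {g : SmoothMetric m M} {e : OpenPartialHomeomorph M (EuclideanSpace ℝ (Fin m))}
  {y : EuclideanSpace ℝ (Fin m)} {φ : M → EuclideanSpace ℝ (Fin (n + 1))}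

section Linear

variable {V : Type*} [NormedAddCommGroup V] [NormedSpace ℝ V]
  {F G : EuclideanSpace ℝ (Fin m) → V}

theorem coordLaplacian_eqOn (g : SmoothMetric m M) (h : Set.EqOn F G e.target) :
    Set.EqOn (coordLaplacian g e F) (coordLaplacian g e G) e.target := fun y hy => by
  have hU := e.open_target
  simp only [coordLaplacian, partialD_eqOn hU h _ hy,
    partialD_eqOn hU (partialD_eqOn hU h _) _ hy]

theorem coordLaplacian_const_smul (g : SmoothMetric m M) (c : ℝ) :
    coordLaplacian g e (fun z => c • F z) y = c • coordLaplacian g e F y := by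
  have h : ∀ j, partialD j (fun z => c • F z) = fun z => c • partialD j F z := fun j =>
    funext fun z => partialD_const_smul c F j
  simp only [coordLaplacian, h, partialD_const_smul, Finset.smul_sum, smul_sub]
  simp only [smul_comm c]

theorem coordLaplacian_add (g : SmoothMetric m M) (hF : ContDiffOn ℝ ∞ F e.target)
    (hG : ContDiffOn ℝ ∞ G e.target) (hy : y ∈ e.target) :
    coordLaplacian g e (fun z => F z + G z) y =
      coordLaplacian g e F y + coordLaplacian g e G y := by
  have hU := e.open_target
  have h : ∀ j, Set.EqOn (partialD j (fun z => F z + G z))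
      (fun z => partialD j F z + partialD j G z) e.target := fun j z hz =>
    partialD_add j (differentiableAt_of_contDiffOn hU hF hz)
      (differentiableAt_of_contDiffOn hU hG hz)
  have h2 : ∀ i j, partialD i (partialD j (fun z => F z + G z)) y =
      partialD i (partialD j F) y + partialD i (partialD j G) y := fun i j => by
    rw [partialD_eqOn hU (h j) i hy]
    exact partialD_add i (differentiableAt_of_contDiffOn hU (contDiffOn_partialD hU hF j) hy)
      (differentiableAt_of_contDiffOn hU (contDiffOn_partialD hU hG j) hy)
  simp only [coordLaplacian, h2, h _ hy, ← Finset.sum_add_distrib]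
  refine Finset.sum_congr rfl fun i _ => Finset.sum_congr rfl fun j _ => ?_
  rw [← smul_add]
  congr 1
  simp only [smul_add, Finset.sum_add_distrib]
  abel

end Linear

/-- The function on `M` which is given by `ζ` in the chart `e` and vanishes outside its domain. -/
def chartExtend {V : Type*} [Zero V] (e : OpenPartialHomeomorph M (EuclideanSpace ℝ (Fin m)))
    (ζ : EuclideanSpace ℝ (Fin m) → V) : M → V :=
  e.source.indicator (ζ ∘ e)

theorem chartExtend_eq_zero {V : Type*} [Zero V] {ζ : EuclideanSpace ℝ (Fin m) → V}
    {B : Set (EuclideanSpace ℝ (Fin m))} (h0 : ∀ z ∉ B, ζ z = 0) {x : M}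
    (hx : x ∉ e.symm '' B) : chartExtend e ζ x = 0 := by
  by_cases hxs : x ∈ e.source
  · rw [chartExtend, Set.indicator_of_mem hxs]
    exact h0 _ fun hB => hx ⟨e x, hB, e.left_inv hxs⟩
  · exact Set.indicator_of_notMem hxs _

/-- The Hausdorff property makes the compact set `e.symm '' B` closed in `M`, so the extension
vanishes near every point outside the chart domain. -/
theorem contMDiff_chartExtend [T2Space M] (he : IsSmoothChart e)
    {ζ : EuclideanSpace ℝ (Fin m) → EuclideanSpace ℝ (Fin (n + 1))} (hζ : ContDiff ℝ ∞ ζ)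
    {B : Set (EuclideanSpace ℝ (Fin m))} (hB : IsCompact B) (hBe : B ⊆ e.target)
    (h0 : ∀ z ∉ B, ζ z = 0) : ContMDiff (𝓡 m) (𝓡 (n + 1)) ∞ (chartExtend e ζ) := by
  intro x
  by_cases hx : x ∈ e.source
  · have h1 : chartExtend e ζ =ᶠ[nhds x] ζ ∘ e := by
      filter_upwards [e.open_source.mem_nhds hx] with z hz using Set.indicator_of_mem hz _
    exact ((hζ.contMDiff (e x)).comp x
      (contMDiffAt_of_mem_maximalAtlas he hx)).congr_of_eventuallyEq h1
  · have hK : IsClosed (e.symm '' B) :=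
      (hB.image_of_continuousOn (e.symm.continuousOn.mono hBe)).isClosed
    have hxK : x ∉ e.symm '' B := by
      rintro ⟨z, hz, rfl⟩
      exact hx (e.map_target (hBe hz))
    have h1 : chartExtend e ζ =ᶠ[nhds x] fun _ => 0 := by
      filter_upwards [hK.isOpen_compl.mem_nhds hxK] with z hz using chartExtend_eq_zero h0 hz
    exact contMDiffAt_const.congr_of_eventuallyEq h1

/-- The variation `(φ + tV) / |φ + tV|` of a map into the unit sphere with velocity field `V`,
written for a field `V` orthogonal to `φ`. -/
def normalizedVariation (φ V : M → EuclideanSpace ℝ (Fin (n + 1))) (t : ℝ) (x : M) :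
    EuclideanSpace ℝ (Fin (n + 1)) :=
  (√(1 + t ^ 2 * ‖V x‖ ^ 2))⁻¹ • (φ x + t • V x)

/-- As `V ⟂ φ` and `|φ| = 1`, one has `|φ + tV|² = 1 + t²|V|²`. This never vanishes, so the
variation is smooth for all `t`. -/
theorem isSphereVariation_normalizedVariation {V : M → EuclideanSpace ℝ (Fin (n + 1))}
    (hφ : ContMDiff (𝓡 m) (𝓡 (n + 1)) ∞ φ) (h1 : ∀ x, ‖φ x‖ = 1)
    (hV : ContMDiff (𝓡 m) (𝓡 (n + 1)) ∞ V) (horth : ∀ x, inner ℝ (φ x) (V x) = 0)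
    {K : Set M} (hK : ∀ x ∉ K, V x = 0) :
    IsSphereVariation m φ K (normalizedVariation φ V) where
  smooth := by
    let S : ℝ × EuclideanSpace ℝ (Fin (n + 1)) × EuclideanSpace ℝ (Fin (n + 1)) →
        EuclideanSpace ℝ (Fin (n + 1)) :=
      fun p => (√(1 + p.1 ^ 2 * ‖p.2.2‖ ^ 2))⁻¹ • (p.2.1 + p.1 • p.2.2)
    have hS : ContDiff ℝ ∞ S := by
      have hb : ContDiff ℝ ∞ (fun p : ℝ × EuclideanSpace ℝ (Fin (n + 1)) ×
          EuclideanSpace ℝ (Fin (n + 1)) => 1 + p.1 ^ 2 * ‖p.2.2‖ ^ 2) :=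
        contDiff_const.add ((contDiff_fst.pow 2).mul ((contDiff_snd.comp contDiff_snd).norm_sq ℝ))
      have hp : ∀ p : ℝ × EuclideanSpace ℝ (Fin (n + 1)) × EuclideanSpace ℝ (Fin (n + 1)),
          0 < 1 + p.1 ^ 2 * ‖p.2.2‖ ^ 2 := fun p => by positivity
      exact ((hb.sqrt fun p => (hp p).ne').inv fun p => (Real.sqrt_pos.2 (hp p)).ne').smul
        (by fun_prop)
    exact hS.contMDiff.comp (contMDiff_fst.prodMk_space
      ((hφ.comp contMDiff_snd).prodMk_space (hV.comp contMDiff_snd)))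
  mem_sphere t x := by
    have hpos : 0 < 1 + t ^ 2 * ‖V x‖ ^ 2 := by positivity
    have hn : ‖φ x + t • V x‖ = √(1 + t ^ 2 * ‖V x‖ ^ 2) := by
      rw [← Real.sqrt_sq (norm_nonneg (φ x + t • V x)), norm_add_sq_real, inner_smul_right,
        horth, h1, norm_smul, mul_pow, Real.norm_eq_abs, sq_abs]
      norm_num
    rw [mem_sphere_zero_iff_norm, normalizedVariation, norm_smul, hn, Real.norm_eq_abs,
      abs_of_nonneg (by positivity), inv_mul_cancel₀ (Real.sqrt_pos.2 hpos).ne']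
  initial := by
    funext x
    simp [normalizedVariation]
  eq_off t x hx := by simp [normalizedVariation, hK x hx]

/-- The normalizing factor is even in `t`, so it contributes nothing at first order. -/
theorem hasDerivAt_normalizedVariation (V : M → EuclideanSpace ℝ (Fin (n + 1))) (x : M) :
    HasDerivAt (fun t => normalizedVariation φ V t x) (V x) 0 := by
  have h1 : HasDerivAt (fun t : ℝ => 1 + t ^ 2 * ‖V x‖ ^ 2) 0 0 := by
    simpa using (((hasDerivAt_id (0 : ℝ)).fun_pow 2).mul_const (‖V x‖ ^ 2)).const_add 1
  have h2 : HasDerivAt (fun t : ℝ => (√(1 + t ^ 2 * ‖V x‖ ^ 2))⁻¹) 0 0 := by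
    simpa using (h1.sqrt (by simp)).fun_inv (by simp)
  have h3 : HasDerivAt (fun t : ℝ => φ x + t • V x) (V x) 0 := by
    simpa using ((hasDerivAt_id (0 : ℝ)).smul_const (V x)).const_add (φ x)
  exact (h2.fun_smul h3).congr_deriv (by simp)

end Variation

/-! ### Vanishing of the tension field and its consequences. -/

section Main

open MeasureTheory

variable {m n : ℕ} {M : Type*} [TopologicalSpace M]
  [ChartedSpace (EuclideanSpace ℝ (Fin m)) M] [IsManifold (𝓡 m) ∞ M]
  {g : SmoothMetric m M} {e : OpenPartialHomeomorph M (EuclideanSpace ℝ (Fin m))}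
  {y : EuclideanSpace ℝ (Fin m)} {φ : M → EuclideanSpace ℝ (Fin (n + 1))}

/-- The weak form of the biharmonic equation of an isometric immersion into the sphere. -/
theorem integral_inner_tensionField_eq_zero [T2Space M] (he : IsSmoothChart e)
    (hφ : IsIsometricImmersion g φ) (hbi : IsBiharmonicIntoSphere g φ)
    {ζ : EuclideanSpace ℝ (Fin m) → EuclideanSpace ℝ (Fin (n + 1))} (hζ : ContDiff ℝ ∞ ζ)
    (hc : HasCompactSupport ζ) (hs : tsupport ζ ⊆ e.target)
    (horth : ∀ z ∈ e.target, inner ℝ (φ (e.symm z)) (ζ z) = 0) :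
    ∫ y, (inner ℝ (tensionField g e φ y) (coordLaplacian g e ζ y) +
      m * inner ℝ (tensionField g e φ y) (ζ y)) * volumeDensity g e y = 0 := by
  have h1 : ∀ x, ‖φ x‖ = 1 := fun x => mem_sphere_zero_iff_norm.1 (hbi.2.1 x)
  set B := tsupport ζ
  have hB : IsCompact B := hc
  have h0 : ∀ z ∉ B, ζ z = 0 := fun z hz => image_eq_zero_of_notMem_tsupport hz
  set K := e.symm '' B
  have hK : IsCompact K := hB.image_of_continuousOn (e.symm.continuousOn.mono hs)
  have hKe : K ⊆ e.source := by
    rintro _ ⟨z, hz, rfl⟩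
    exact e.map_target (hs hz)
  have heK : e '' K = B := by
    rw [← Set.image_comp]
    exact (Set.image_congr fun z hz => e.right_inv (hs hz)).trans (Set.image_id B)
  set V := chartExtend e ζ
  have hVz : ∀ z ∈ e.target, V (e.symm z) = ζ z := fun z hz => by
    change e.source.indicator (ζ ∘ e) (e.symm z) = ζ z
    rw [Set.indicator_of_mem (e.map_target hz), Function.comp_apply, e.right_inv hz]
  have hVorth : ∀ x, inner ℝ (φ x) (V x) = 0 := fun x => by
    by_cases hx : x ∈ e.source
    · have := horth (e x) (e.map_source hx)
      rwa [← hVz _ (e.map_source hx), e.left_inv hx] at this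
    · have : V x = 0 := Set.indicator_of_notMem hx _
      rw [this, inner_zero_right]
  have hΨ := isSphereVariation_normalizedVariation hφ.1 h1
    (contMDiff_chartExtend he hζ hB hs h0) hVorth (K := K) (fun x hx => chartExtend_eq_zero h0 hx)
  have hE := (hasDerivAt_bienergyOn he hφ h1 hK hKe hΨ).unique (hbi.2.2 e he K hK hKe _ hΨ)
  have hv : Set.EqOn (fun z => deriv (fun t => normalizedVariation φ V t (e.symm z)) 0) ζ
      e.target := fun z hz =>
    (hasDerivAt_normalizedVariation V (e.symm z)).deriv.trans (hVz z hz)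
  rw [heK] at hE
  -- The integrand vanishes off `B = e '' K`, so the bienergy integral extends to all of `ℝᵐ`.
  rw [← hE, ← setIntegral_eq_integral_of_forall_compl_eq_zero (s := B) fun z hz => ?_]
  · refine setIntegral_congr_fun hB.measurableSet fun z hz => ?_
    change _ = (inner ℝ _ (coordLaplacian g e
      (fun z => deriv (fun t => normalizedVariation φ V t (e.symm z)) 0) z) +
      m * inner ℝ _ ((fun z => deriv (fun t => normalizedVariation φ V t (e.symm z)) 0) z)) * _
    rw [coordLaplacian_eqOn g hv (hs hz), hv (hs hz)]
  · rw [coordLaplacian_eq_zero_of_notMem_tsupport hz, h0 z hz]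
    simp

/-- The intermediate function `h` is not assumed smooth; it agrees in the chart with the smooth
`Δφ`, which allows the nondivergence form to be used a second time. -/
theorem coordLaplacian_coordLaplacian_of_isBiLaplacian {lam : M → ℝ} (he : IsSmoothChart e)
    (hφ : IsIsometricImmersion g φ) (hlam : IsBiLaplacian g φ (fun x => lam x • φ x))
    (hy : y ∈ e.target) :
    coordLaplacian g e (coordLaplacian g e (φ ∘ e.symm)) y =
      lam (e.symm y) • φ (e.symm y) := by
  obtain ⟨h, hh, hhl⟩ := hlam
  have hg := contDiffOn_metricMatrix he hφ
  have hu := contDiffOn_comp_chart_symm he hφ.1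
  have hEq : Set.EqOn (h ∘ e.symm) (coordLaplacian g e (φ ∘ e.symm)) e.target := fun z hz => by
    rw [Function.comp_apply, hh e he _ (e.map_target hz), e.right_inv hz,
      chartLaplacian_eq_coordLaplacian he hg hu hz]
  have hhs := (contDiffOn_coordLaplacian he hg hu).congr hEq
  have := hhl e he _ (e.map_target hy)
  rw [e.right_inv hy, chartLaplacian_eq_coordLaplacian he hg hhs hy,
    coordLaplacian_eqOn g hEq hy] at this
  exact this.symm

/-- The bump function localizes the test field `fτ` at `y`. A nonzero `τ y` would make `∫ 2m f |τ|²
dv` strictly positive. -/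
theorem tensionField_eq_zero [T2Space M] {lam : M → ℝ} (he : IsSmoothChart e)
    (hφ : IsIsometricImmersion g φ) (hlam : IsBiLaplacian g φ (fun x => lam x • φ x))
    (hbi : IsBiharmonicIntoSphere g φ) (hy : y ∈ e.target) : tensionField g e φ y = 0 := by
  -- For `m = 0` the factor `2m` carries no information, but `τ` is then an empty sum.
  rcases Nat.eq_zero_or_pos m with hm | hm
  · have : IsEmpty (Fin m) := by rw [hm]; infer_instance
    simp [tensionField]
  have h1 : ∀ x, ‖φ x‖ = 1 := fun x => mem_sphere_zero_iff_norm.1 (hbi.2.1 x)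
  have hg := contDiffOn_metricMatrix he hφ
  have hu := contDiffOn_comp_chart_symm he hφ.1
  have hU := e.open_target
  set τ := tensionField g e φ
  have hτ : ContDiffOn ℝ ∞ τ e.target := contDiffOn_tensionField he hφ h1
  have hLu : ∀ z ∈ e.target, coordLaplacian g e (φ ∘ e.symm) z = τ z - (m : ℝ) • φ (e.symm z) :=
    fun z hz => eq_sub_of_add_eq (tensionField_of_isometricImmersion he hφ h1 hz).symm
  have hLτ : ∀ z ∈ e.target, coordLaplacian g e τ z =
      lam (e.symm z) • φ (e.symm z) + (m : ℝ) • (τ z - (m : ℝ) • φ (e.symm z)) := fun z hz => by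
    have h2 : Set.EqOn τ (fun z => coordLaplacian g e (φ ∘ e.symm) z +
        (m : ℝ) • (φ ∘ e.symm) z) e.target := fun w hw =>
      tensionField_of_isometricImmersion he hφ h1 hw
    rw [coordLaplacian_eqOn g h2 hz, coordLaplacian_add g (contDiffOn_coordLaplacian he hg hu)
      (hu.const_smul (m : ℝ)) hz, coordLaplacian_const_smul, hLu z hz]
    exact congrArg (· + _) (coordLaplacian_coordLaplacian_of_isBiLaplacian he hφ hlam hz)
  have hort : ∀ z ∈ e.target, inner ℝ (φ (e.symm z)) (τ z) = 0 := fun z hz =>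
    inner_tensionField he hφ h1 hz
  obtain ⟨r, hr, hrU⟩ := Metric.nhds_basis_closedBall.mem_iff.1 (hU.mem_nhds hy)
  let f : ContDiffBump y := ⟨r / 2, r, by positivity, by linarith⟩
  have hf : ContDiffOn ℝ ∞ f e.target := f.contDiff.contDiffOn
  have hf0 : ∀ z ∉ Metric.closedBall y r, f z = 0 := fun z hz =>
    image_eq_zero_of_notMem_tsupport (by rwa [f.tsupport_eq])
  -- Admissible as a variation field because `τ ⟂ φ`.
  set ζ : EuclideanSpace ℝ (Fin m) → EuclideanSpace ℝ (Fin (n + 1)) := fun z => f z • τ z with hζd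
  have hζ0 : ∀ z ∉ Metric.closedBall y r, ζ z = 0 := fun z hz => by simp [hζd, hf0 z hz]
  have hζ : ContDiff ℝ ∞ ζ := contDiff_of_contDiffOn_of_eqOn_zero hU Metric.isClosed_closedBall
    hrU (hf.smul hτ) hζ0
  have hζt : tsupport ζ ⊆ Metric.closedBall y r :=
    closure_minimal (fun z hz => by_contra fun h => hz (hζ0 z h)) Metric.isClosed_closedBall
  have hζc : HasCompactSupport ζ :=
    (isCompact_closedBall y r).of_isClosed_subset (isClosed_tsupport ζ) hζt
  have hw := integral_inner_tensionField_eq_zero he hφ hbi hζ hζc (hζt.trans hrU) fun z hz => by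
    simp only [hζd, inner_smul_right, hort z hz, mul_zero]
  obtain ⟨hGi, hG⟩ := coordLaplacian_symmetric he hg hτ hζ.contDiffOn hζc (hζt.trans hrU)
  set R : EuclideanSpace ℝ (Fin m) → ℝ :=
    fun z => f z * (2 * m * ‖τ z‖ ^ 2 * volumeDensity g e z) with hR
  have hR0 : ∀ z ∉ Metric.closedBall y r, R z = 0 := fun z hz => by simp [hR, hf0 z hz]
  have hRs : ContDiff ℝ ∞ R := contDiff_of_contDiffOn_of_eqOn_zero hU Metric.isClosed_closedBall
    hrU (hf.mul ((contDiffOn_const.mul (hτ.norm_sq ℝ)).mul (contDiffOn_volumeDensity he hg))) hR0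
  have hRc : HasCompactSupport R := HasCompactSupport.intro (isCompact_closedBall y r) hR0
  -- The weak equation is the Green integrand, of integral zero, plus `⟨Δτ + mτ, fτ⟩ √det g`; the
  -- latter is `R`, since the `φ` part of `Δτ` is orthogonal to `τ`.
  have hsplit : (fun z => (inner ℝ (τ z) (coordLaplacian g e ζ z) +
      m * inner ℝ (τ z) (ζ z)) * volumeDensity g e z) =
      fun z => (inner ℝ (τ z) (coordLaplacian g e ζ z) -
        inner ℝ (coordLaplacian g e τ z) (ζ z)) * volumeDensity g e z + R z := by
    funext z
    by_cases hz : z ∈ e.target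
    · have h2 : inner ℝ (coordLaplacian g e τ z) (ζ z) = f z * (m * ‖τ z‖ ^ 2) := by
        rw [hLτ z hz]
        simp only [hζd, inner_smul_right, inner_add_left, inner_smul_left, inner_sub_left,
          hort z hz, real_inner_self_eq_norm_sq]
        simp
      have h3 : inner ℝ (τ z) (ζ z) = f z * ‖τ z‖ ^ 2 := by
        simp only [hζd, inner_smul_right, real_inner_self_eq_norm_sq]
      rw [h2, h3]
      simp only [hR]
      ring
    · have hz' : z ∉ Metric.closedBall y r := fun h => hz (hrU h)
      rw [hζ0 z hz', hR0 z hz']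
      simp
  have hRi := hRs.continuous.integrable_of_hasCompactSupport (μ := volume) hRc
  rw [hsplit, integral_add hGi hRi, hG, zero_add] at hw
  have hRnn : 0 ≤ R := fun z =>
    mul_nonneg f.nonneg (mul_nonneg (by positivity) (Real.sqrt_nonneg _))
  by_contra hne
  have hpos := hRs.continuous.integral_pos_of_hasCompactSupport_nonneg_nonzero (μ := volume)
    hRc hRnn (x := y) <| by
      have hfy : f y = 1 := f.one_of_mem_closedBall (Metric.mem_closedBall_self (by positivity))
      have := norm_pos_iff.2 hne
      have := volumeDensity_pos g he hy
      simp only [hR, hfy]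
      positivity
  exact hpos.ne' hw

theorem isLaplacian_of_isBiLaplacian_of_isBiharmonicIntoSphere [T2Space M] {lam : M → ℝ}
    (hφ : IsIsometricImmersion g φ) (hlam : IsBiLaplacian g φ (fun x => lam x • φ x))
    (hbi : IsBiharmonicIntoSphere g φ) : IsLaplacian g φ (fun x => (-(m : ℝ)) • φ x) := by
  intro e he x hx
  have h1 : ∀ x, ‖φ x‖ = 1 := fun x => mem_sphere_zero_iff_norm.1 (hbi.2.1 x)
  have hy := e.map_source hx
  have h2 := tensionField_of_isometricImmersion he hφ h1 hy
  rw [tensionField_eq_zero he hφ hlam hbi hy, e.left_inv hx] at h2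
  rw [chartLaplacian_eq_coordLaplacian he (contDiffOn_metricMatrix he hφ)
    (contDiffOn_comp_chart_symm he hφ.1) hy, eq_neg_of_add_eq_zero_left h2.symm]
  exact neg_smul _ _

/-- The normal projection kills `φ` and every `∂ₖφ`. Applied to `Δφ = -mφ`, it leaves the trace of
the second fundamental form on one side and zero on the other. -/
theorem isMinimalInSphere_of_isLaplacian (hφ : IsIsometricImmersion g φ)
    (hS : ∀ x, φ x ∈ Metric.sphere (0 : EuclideanSpace ℝ (Fin (n + 1))) 1)
    (hL : IsLaplacian g φ (fun x => (-(m : ℝ)) • φ x)) : IsMinimalInSphere g φ := by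
  refine ⟨hφ, hS, fun e he x hx => ?_⟩
  have hy := e.map_source hx
  set y := e x
  have h2 := hL e he x hx
  rw [chartLaplacian_eq_coordLaplacian he (contDiffOn_metricMatrix he hφ)
    (contDiffOn_comp_chart_symm he hφ.1) hy] at h2
  have hP : ∀ v ∈ Submodule.span ℝ
      (insert (φ (e.symm y)) (Set.range fun k => partialD k (φ ∘ e.symm) y)),
      (normalSpace e φ y).starProjection v = 0 := fun v hv =>
    Submodule.starProjection_apply_eq_zero_iff _ |>.2 (Submodule.le_orthogonal_orthogonal _ hv)
  have hPk : ∀ k, (normalSpace e φ y).starProjection (partialD k (φ ∘ e.symm) y) = 0 := fun k =>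
    hP _ (Submodule.subset_span (Set.mem_insert_of_mem _ ⟨k, rfl⟩))
  have hPφ : (normalSpace e φ y).starProjection (φ x) = 0 := by
    have := hP _ (Submodule.subset_span (Set.mem_insert _ _))
    rwa [e.left_inv hx] at this
  have h3 := congrArg (normalSpace e φ y).starProjection h2
  simp only [coordLaplacian, map_sum, map_smul, map_sub, hPk, hPφ, smul_zero,
    Finset.sum_const_zero, sub_zero] at h3
  rw [meanCurvatureVector, ← h3, smul_zero]

/-- Applying `Δφ = -mφ` twice gives `m²φ = λφ`, and `φ` never vanishes. -/
theorem eq_of_isBiLaplacian_of_isLaplacian {lam : M → ℝ} (hφ : IsIsometricImmersion g φ)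
    (h1 : ∀ x, ‖φ x‖ = 1) (hlam : IsBiLaplacian g φ (fun x => lam x • φ x))
    (hL : IsLaplacian g φ (fun x => (-(m : ℝ)) • φ x)) (x : M) : lam x = (m : ℝ) ^ 2 := by
  let e := chartAt (EuclideanSpace ℝ (Fin m)) x
  have he : IsSmoothChart e := IsManifold.chart_mem_maximalAtlas x
  have hx : x ∈ e.source := mem_chart_source _ x
  have hy := e.map_source hx
  have hLu : Set.EqOn (coordLaplacian g e (φ ∘ e.symm)) (fun z => (-(m : ℝ)) • (φ ∘ e.symm) z)
      e.target := fun z hz => by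
    have := hL e he _ (e.map_target hz)
    rw [e.right_inv hz, chartLaplacian_eq_coordLaplacian he (contDiffOn_metricMatrix he hφ)
      (contDiffOn_comp_chart_symm he hφ.1) hz] at this
    exact this.symm
  have h2 := coordLaplacian_coordLaplacian_of_isBiLaplacian he hφ hlam hy
  rw [coordLaplacian_eqOn g hLu hy, coordLaplacian_const_smul, hLu hy] at h2
  simp only [Function.comp_apply] at h2
  rw [e.left_inv hx, smul_smul] at h2
  have hne : φ x ≠ 0 := norm_ne_zero_iff.1 (by simp [h1 x])
  have := smul_left_injective ℝ hne h2
  rw [← this]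
  ring

end Main

end BiharmonicSphere

end

theorem theorem2p3 {m n : ℕ} {M : Type*} [TopologicalSpace M] [T2Space M]
    [ChartedSpace (EuclideanSpace ℝ (Fin m)) M] [IsManifold (𝓡 m) ∞ M]
    (g : BiharmonicSphere.SmoothMetric m M)
    (φ : M → EuclideanSpace ℝ (Fin (n + 1)))
    (hφ : BiharmonicSphere.IsIsometricImmersion g φ)
    (lam : M → ℝ)
    (hlam : BiharmonicSphere.IsBiLaplacian g φ (fun x => lam x • φ x))
    (hbi : BiharmonicSphere.IsBiharmonicIntoSphere g φ) :
    (∀ x, lam x = (m : ℝ) ^ 2) ∧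
      BiharmonicSphere.IsMinimalInSphere g φ ∧
      BiharmonicSphere.IsLaplacian g φ (fun x => (-(m : ℝ)) • φ x) := by
  have hL := BiharmonicSphere.isLaplacian_of_isBiLaplacian_of_isBiharmonicIntoSphere hφ hlam hbi
  exact ⟨BiharmonicSphere.eq_of_isBiLaplacian_of_isLaplacian hφ
      (fun x => mem_sphere_zero_iff_norm.1 (hbi.2.1 x)) hlam hL,
    BiharmonicSphere.isMinimalInSphere_of_isLaplacian hφ hbi.2.1 hL, hL⟩
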